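/- Let $N\ge 2$ bidders compete in a second-price auction. Let $V\subseteq[0,1]$ be a countable (discrete) set with largest element $\bar v$, and let the value profile $v=(v_1,\dots,v_N)\in V^N$ have a symmetric (exchangeable) prior law $\lambda$; write $\mathrm{supp}(\lambda)=\{v:\lambda(v)>0\}$ and $\overline{W}=\mathbb{E}_{v\sim\lambda}[\max_i v_i]$. An information structure $\mathcal I$ consists of measurable signal spaces $S_1,\dots,S_N$ and a probability law $\pi$ of $(v,s)$ on $V^N\times\prod_i S_i$ whose marginal on $V^N$ is $\lambda$. It is private private if the signals $s_1,\dots,s_N$ are independent under $\pi$. A strategy of bidder $i$ is a measurable map $\sigma_i$ from $S_i$ to probability measures on the bid space $[0,\bar v]$; given $s$, the bids $b_i\sim\sigma_i(s_i)$ are drawn independently across bidders (and independently of $v$). The good goes to a highest bidder, with uniform tie-breaking (allocation probabilities $\omega_i(b)$), who pays the second highest bid $\mathrm{secmax}(b)$. Put $$\mathrm{BS}_i(\mathcal I,\sigma)=\mathbb{E}\big[\omega_i(b)\,(v_i-\mathrm{secmax}(b))\big],\qquad \mathrm{BS}=\sum_i \mathrm{BS}_i,\qquad \mathrm{WEL}(\mathcal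 I,\sigma)=\mathbb{E}\Big[\sum_i\omega_i(b)\,v_i\Big].$$ An equilibrium is a strategy profile $\sigma$ such that $\mathrm{BS}_i(\mathcal I,\sigma)\ge \mathrm{BS}_i(\mathcal I,\sigma_i',\sigma_{-i})$ for every $i$ and every strategy $\sigma_i'$ of bidder $i$, and such that (almost surely) no bidder bids an amount which, given her signal, is sure to be strictly greater than her value. It is efficient if $\mathrm{WEL}(\mathcal I,\sigma)=\overline W$. Proposition. The following are equivalent. (a) For every $\varepsilon>0$ there exist a private private information structure $\mathcal I$ and an efficient equilibrium $\sigma$ under $\mathcal I$ with $\mathrm{BS}(\mathcal I,\sigma)\ge\overline W-\varepsilon$. (b) For every $v\in\mathrm{supp}(\lambda)$, either $v_i=v_j$ for all $i,j$, or there is a bidder $i$ with $v_i>0$ and $v_j=0$ for all $j\ne i$. -/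

import Mathlib

open MeasureTheory ProbabilityTheory

noncomputable section

namespace SecondPrice

/-- The uniform tie-breaking allocation rule: the highest bidders share the good equally. -/
def alloc {N : ℕ} (i : Fin N) (b : Fin N → ℝ) : ℝ :=
  open Classical in
  if ∀ j, b j ≤ b i then
    1 / ((Finset.univ.filter fun j : Fin N => ∀ k, b k ≤ b j).card : ℝ)
  else 0

/-- The second highest bid, counted with multiplicity: the largest number that
is at most the bids of two distinct bidders. -/
def secmax {N : ℕ} (b : Fin N → ℝ) : ℝ :=
  ⨆ p : {p : Fin N × Fin N // p.1 ≠ p.2}, min (b p.1.1) (b p.1.2)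

/-- The maximum welfare `E[max v]`. -/
def maxWelfare {N : ℕ} (lam : PMF (Fin N → ℝ)) : ℝ :=
  ∫ v, (⨆ i, v i) ∂lam.toMeasure

/-- An information structure for the prior `lam`: a measurable signal space for every bidder and
a joint law of the value profile and the signal profile whose value marginal is the prior. -/
structure InfoStructure {N : ℕ} (lam : PMF (Fin N → ℝ)) where
  S : Fin N → Type
  [mS : ∀ i, MeasurableSpace (S i)]
  law : Measure ((Fin N → ℝ) × (∀ i, S i))
  marginal : law.map Prod.fst = lam.toMeasure

attribute [instance] InfoStructure.mS

/-- A (behavioural) bidding strategy: a measurable map from signals to probability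
measures on the bid space `[0, bmax]`. -/
structure Strategy (S : Type) [MeasurableSpace S] (bmax : ℝ) where
  kernel : Kernel S ℝ
  [markov : IsMarkovKernel kernel]
  supported : ∀ s, ∀ᵐ b ∂(kernel s), b ∈ Set.Icc 0 bmax

attribute [instance] Strategy.markov

namespace InfoStructure

variable {N : ℕ} {lam : PMF (Fin N → ℝ)} (I : InfoStructure lam)

instance : IsProbabilityMeasure I.law := by
  constructor
  have h : I.law.map Prod.fst Set.univ = lam.toMeasure Set.univ := by rw [I.marginal]
  rw [Measure.map_apply measurable_fst MeasurableSet.univ] at h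
  simpa using h

/-- The marginal law of bidder `i`'s signal. -/
def signalLaw (i : Fin N) : Measure (I.S i) := I.law.map fun p => p.2 i

instance (i : Fin N) : IsProbabilityMeasure (I.signalLaw i) :=
  Measure.isProbabilityMeasure_map
    (((measurable_pi_apply i).comp measurable_snd).aemeasurable)

/-- Private private: the joint law of the signals is the product of its marginals. -/
def IsPrivatePrivate : Prop :=
  I.law.map Prod.snd = Measure.pi I.signalLaw

/-- The posterior belief of bidder `i` about her own value, given her signal. -/
def posterior (i : Fin N) : Kernel (I.S i) ℝ :=
  condDistrib (fun p : (Fin N → ℝ) × (∀ j, I.S j) => p.1 i) (fun p => p.2 i) I.law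

/-- A strategy profile, with bid space `[0, bmax]`. -/
abbrev Profile (bmax : ℝ) : Type := ∀ i, Strategy (I.S i) bmax

variable {bmax : ℝ}

/-- The law of the bid profile, given the signal profile `s`. -/
def bidLaw (σ : I.Profile bmax) (s : ∀ i, I.S i) : Measure (Fin N → ℝ) :=
  Measure.pi fun i => (σ i).kernel (s i)

/-- Bidder `i`'s ex ante surplus. -/
def surplus (σ : I.Profile bmax) (i : Fin N) : ℝ :=
  ∫ p, (∫ b, alloc i b * (p.1 i - secmax b) ∂(I.bidLaw σ p.2)) ∂I.law

/-- The total surplus of the bidders. -/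
def bidderSurplus (σ : I.Profile bmax) : ℝ := ∑ i, I.surplus σ i

/-- The welfare (total surplus of bidders and seller). -/
def welfare (σ : I.Profile bmax) : ℝ :=
  ∫ p, (∫ b, ∑ i, alloc i b * p.1 i ∂(I.bidLaw σ p.2)) ∂I.law

/-- Bayes Nash equilibrium. -/
def IsBNE (σ : I.Profile bmax) : Prop :=
  ∀ (i : Fin N) (τ : Strategy (I.S i) bmax),
    I.surplus (Function.update σ i τ) i ≤ I.surplus σ i

/-- No bidder ever bids an amount that, given her signal, is sure to be strictly greater
than her value. -/
def NoOverbidding (σ : I.Profile bmax) : Prop :=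
  ∀ i, ∀ᵐ s ∂(I.signalLaw i), ∀ᵐ b ∂((σ i).kernel s), ¬ ∀ᵐ x ∂(I.posterior i s), x < b

/-- The outcome achieves the maximum welfare. -/
def IsEfficient (σ : I.Profile bmax) : Prop := I.welfare σ = maxWelfare lam

end InfoStructure

end SecondPrice

end

/-! Bidder surplus is welfare minus the expected second highest bid, so (a) asks for efficient
equilibria with arbitrarily little revenue.

Necessity. Let revenue be at most `t ^ 3`. By Markov, two given bidders both bid above `t` with
probability at most `t ^ 2`; bids are independent, so every bidder except some `e` bids above `t`
with probability at most `t` (`exists_others_low`). A deviation to the constant bid `2 * t` wins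
whenever all others bid at most `t`, so in equilibrium the expected value forgone on that event is
of order `t` (`integral_forgone_le`). Take a profile `v` in the support with unequal values and at
least two positive ones; by symmetry `e` may be assumed to lack the highest value. Efficiency denies
`e` the good, so when the others bid low `e` bids low as well. All bidders could then win with `2 *
t`, and the forgone values add up to `∑ v - max v > 0`, on an event of probability at least `lam v -
N * t` (`excess_mul_prob_le`). This is impossible for small `t`.

Sufficiency. Bidder `0` learns whether all values are positive, hence equal. Each bidder `k > 0`
sees an independent record indicator of probability `1 / (k + 1)`. As for records in an exchangeable
sequence, the last record is uniform over bidders. By symmetry so is the bidder with the only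
positive value, and she can be made the last record without any dependence between signals. Records
bid along a ladder that increases to a small `L`, non-records bid `0`, and bidder `0` bids the
expected common value `B` on good news. After good news rivals would have to pay `B`, exactly the
expected value; otherwise the last record wins at a price at most `L`, and the losers have value
`0`. So every bid is optimal even given the whole signal profile, and the second highest bid never
exceeds `L`. -/

noncomputable section

namespace SecondPrice

/-! ### Allocation and price for a fixed bid profile -/

section Auction

variable {N : ℕ}

lemma alloc_of_max {i : Fin N} {b : Fin N → ℝ} (h : ∀ j, b j ≤ b i) :
    alloc i b = 1 / (Set.ncard {j : Fin N | ∀ k, b k ≤ b j} : ℝ) := by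
  classical
  rw [alloc, if_pos h, Set.ncard_eq_toFinset_card']
  congr 3
  ext j
  simp

lemma alloc_eq_zero {i j : Fin N} {b : Fin N → ℝ} (h : b i < b j) : alloc i b = 0 := by
  rw [alloc, if_neg]
  intro h'
  exact absurd (h' j) (not_le.2 h)

lemma alloc_nonneg (i : Fin N) (b : Fin N → ℝ) : 0 ≤ alloc i b := by
  by_cases h : ∀ j, b j ≤ b i
  · rw [alloc_of_max h]; positivity
  · rw [alloc, if_neg h]

lemma sum_alloc (hN : 0 < N) (b : Fin N → ℝ) : ∑ i, alloc i b = 1 := by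
  classical
  have : Nonempty (Fin N) := ⟨⟨0, hN⟩⟩
  obtain ⟨m, hm⟩ := Finite.exists_max b
  have hpos : 0 < (Finset.univ.filter fun j : Fin N => ∀ k, b k ≤ b j).card :=
    Finset.card_pos.2 ⟨m, by simpa using hm⟩
  unfold alloc
  rw [← Finset.sum_filter, Finset.sum_const, nsmul_eq_mul]
  have hne : ((Finset.univ.filter fun j : Fin N => ∀ k, b k ≤ b j).card : ℝ) ≠ 0 := by
    exact_mod_cast hpos.ne'
  convert mul_one_div_cancel hne

lemma alloc_le_one (i : Fin N) (b : Fin N → ℝ) : alloc i b ≤ 1 := by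
  rw [← sum_alloc i.pos b]
  exact Finset.single_le_sum (fun j _ => alloc_nonneg j b) (Finset.mem_univ i)

lemma alloc_eq_one {i : Fin N} {b : Fin N → ℝ} (h : ∀ j, j ≠ i → b j < b i) :
    alloc i b = 1 := by
  rw [← sum_alloc i.pos b, Finset.sum_eq_single i]
  · exact fun j _ hj => alloc_eq_zero (h j hj)
  · simp

lemma measurable_alloc (i : Fin N) : Measurable (alloc i) := by
  classical
  have hm : ∀ j : Fin N, MeasurableSet {b : Fin N → ℝ | ∀ k, b k ≤ b j} := fun j => by
    rw [Set.ofPred_forall]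
    exact MeasurableSet.iInter fun k =>
      measurableSet_le (measurable_pi_apply k) (measurable_pi_apply j)
  have : (alloc i : (Fin N → ℝ) → ℝ) = fun b => if ∀ j, b j ≤ b i then
      1 / (∑ j : Fin N, if ∀ k, b k ≤ b j then (1 : ℝ) else 0) else 0 := by
    funext b
    unfold alloc
    simp only [Finset.sum_boole]
  rw [this]
  refine Measurable.ite (hm i) (measurable_const.div ?_) measurable_const
  exact Finset.measurable_sum _ fun j _ => Measurable.ite (hm j) measurable_const measurable_const

lemma min_le_secmax (b : Fin N → ℝ) {i j : Fin N} (hij : i ≠ j) : min (b i) (b j) ≤ secmax b :=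
  le_ciSup (f := fun p : {p : Fin N × Fin N // p.1 ≠ p.2} => min (b p.1.1) (b p.1.2))
    (Set.finite_range _).bddAbove ⟨(i, j), hij⟩

lemma nonempty_pairs (hN : 2 ≤ N) : Nonempty {p : Fin N × Fin N // p.1 ≠ p.2} :=
  ⟨⟨(⟨0, by omega⟩, ⟨1, by omega⟩), by simp⟩⟩

lemma secmax_le (hN : 2 ≤ N) {b : Fin N → ℝ} {c : ℝ}
    (h : ∀ i j, i ≠ j → min (b i) (b j) ≤ c) : secmax b ≤ c := by
  have := nonempty_pairs hN
  exact ciSup_le fun p => h _ _ p.2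

lemma secmax_nonneg {b : Fin N → ℝ} (h : ∀ i, 0 ≤ b i) : 0 ≤ secmax b :=
  Real.iSup_nonneg fun _ => le_min (h _) (h _)

lemma measurable_secmax : Measurable (secmax : (Fin N → ℝ) → ℝ) :=
  Measurable.iSup fun p => (measurable_pi_apply p.1.1).min (measurable_pi_apply p.1.2)

/-- Whenever bidder `i` has a chance to win, the second highest bid is the highest opposing bid `m`,
which her own bid does not affect; otherwise both sides vanish. -/
lemma alloc_mul_secmax (hN : 2 ≤ N) {i : Fin N} {b : Fin N → ℝ} {m : ℝ}
    (hm : ∀ j, j ≠ i → b j ≤ m) (hm' : ∃ j, j ≠ i ∧ b j = m) :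
    alloc i b * secmax b = alloc i b * m := by
  obtain ⟨k, hki, rfl⟩ := hm'
  by_cases h : b i < b k
  · simp [alloc_eq_zero h]
  push Not at h
  congr 1
  apply le_antisymm
  · apply secmax_le hN
    intro x y hxy
    by_cases hx : x = i
    · exact (min_le_right _ _).trans (hm y fun hy => hxy (hx.trans hy.symm))
    · exact (min_le_left _ _).trans (hm x hx)
  · simpa [min_eq_right h] using min_le_secmax b hki.symm

lemma exists_max_others (hN : 2 ≤ N) (i : Fin N) (b : Fin N → ℝ) :
    ∃ m, (∀ j, j ≠ i → b j ≤ m) ∧ ∃ j, j ≠ i ∧ b j = m := by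
  have : Nonempty {j : Fin N // j ≠ i} := by
    have : Nontrivial (Fin N) := Fin.nontrivial_iff_two_le.2 hN
    obtain ⟨j, hj⟩ := exists_ne i
    exact ⟨⟨j, hj⟩⟩
  obtain ⟨k, hk⟩ := Finite.exists_max fun j : {j : Fin N // j ≠ i} => b j
  exact ⟨b k, fun j hj => hk ⟨j, hj⟩, k, k.2, rfl⟩

/-- Against given opposing bids, a bid is optimal as soon as it wins only if the expected value
covers the price, and loses only if it does not. -/
lemma alloc_mul_sub_le_of_best (hN : 2 ≤ N) {i : Fin N} {b b' : Fin N → ℝ} {M q : ℝ}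
    (hbb : ∀ j, j ≠ i → b' j = b j)
    (hwin : ∀ j, j ≠ i → (∀ k, k ≠ i → b k ≤ b j) → b j < b i → q * b j ≤ M)
    (hlose : ∀ j, j ≠ i → (∀ k, k ≠ i → b k ≤ b j) → b i < b j → M ≤ q * b j)
    (htie : ∀ j, j ≠ i → (∀ k, k ≠ i → b k ≤ b j) → b i = b j → M = q * b j) :
    alloc i b' * (M - q * secmax b') ≤ alloc i b * (M - q * secmax b) := by
  obtain ⟨m, hm, k, hk, rfl⟩ := exists_max_others hN i b
  have e1 := alloc_mul_secmax hN hm ⟨k, hk, rfl⟩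
  have e2 := alloc_mul_secmax hN (b := b') (i := i) (m := b k)
    (fun j hj => (hbb j hj).symm ▸ hm j hj) ⟨k, hk, hbb k hk⟩
  have r1 : alloc i b * (M - q * secmax b) = alloc i b * (M - q * b k) := by
    linear_combination (-q) * e1
  have r2 : alloc i b' * (M - q * secmax b') = alloc i b' * (M - q * b k) := by
    linear_combination (-q) * e2
  rw [r1, r2]
  rcases lt_trichotomy (b i) (b k) with h | h | h
  · rw [alloc_eq_zero h, zero_mul]
    exact mul_nonpos_of_nonneg_of_nonpos (alloc_nonneg _ _) (sub_nonpos.2 (hlose k hk hm h))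
  · rw [htie k hk hm h]; simp
  · rw [alloc_eq_one fun j hj => (hm j hj).trans_lt h]
    exact mul_le_mul_of_nonneg_right (alloc_le_one _ _) (sub_nonneg.2 (hwin k hk hm h))

lemma sum_alloc_mul_le (hN : 0 < N) (b v : Fin N → ℝ) : ∑ i, alloc i b * v i ≤ ⨆ i, v i := by
  calc ∑ i, alloc i b * v i ≤ ∑ i, alloc i b * ⨆ j, v j :=
        Finset.sum_le_sum fun i _ => mul_le_mul_of_nonneg_left
          (le_ciSup (Set.finite_range v).bddAbove i) (alloc_nonneg i b)
    _ = ⨆ i, v i := by rw [← Finset.sum_mul, sum_alloc hN, one_mul]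

end Auction

/-! ### The joint law of values, signals and bids; surplus, welfare and revenue -/

namespace InfoStructure

variable {N : ℕ} {lam : PMF (Fin N → ℝ)} (I : InfoStructure lam) {bmax : ℝ}

instance (σ : I.Profile bmax) (s : ∀ i, I.S i) : IsProbabilityMeasure (I.bidLaw σ s) := by
  unfold bidLaw; infer_instance

lemma measurable_bidLaw (σ : I.Profile bmax) : Measurable (I.bidLaw σ) := by
  refine Measurable.measure_of_isPiSystem_of_isProbabilityMeasure generateFrom_pi.symm
    isPiSystem_pi ?_
  rintro _ ⟨A, hA, rfl⟩
  simp only [bidLaw, Measure.pi_pi]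
  exact Finset.measurable_prod _ fun i _ =>
    ((σ i).kernel.measurable_coe (hA i (Set.mem_univ i))).comp (measurable_pi_apply i)

/-- The law of the bid profile as a kernel from states to bid profiles. -/
def bidKernel (σ : I.Profile bmax) : Kernel ((Fin N → ℝ) × (∀ i, I.S i)) (Fin N → ℝ) where
  toFun p := I.bidLaw σ p.2
  measurable' := (I.measurable_bidLaw σ).comp measurable_snd

lemma bidKernel_apply (σ : I.Profile bmax) (p : (Fin N → ℝ) × (∀ i, I.S i)) :
    I.bidKernel σ p = I.bidLaw σ p.2 := rfl

instance (σ : I.Profile bmax) : IsMarkovKernel (I.bidKernel σ) :=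
  ⟨fun p => by rw [bidKernel_apply]; infer_instance⟩

/-- The joint law of values, signals and bids. -/
def outcome (σ : I.Profile bmax) : Measure (((Fin N → ℝ) × (∀ i, I.S i)) × (Fin N → ℝ)) :=
  I.law ⊗ₘ I.bidKernel σ

instance (σ : I.Profile bmax) : IsProbabilityMeasure (I.outcome σ) := by
  unfold outcome; infer_instance

lemma map_outcome_value (σ : I.Profile bmax) :
    (I.outcome σ).map (fun p => p.1.1) = lam.toMeasure := by
  rw [← I.marginal]
  have h : (I.outcome σ).map Prod.fst = I.law := Measure.fst_compProd _ _
  rw [← h, Measure.map_map measurable_fst measurable_fst]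
  rfl

lemma ae_outcome_of_ae_value (σ : I.Profile bmax) {Q : (Fin N → ℝ) → Prop}
    (h : ∀ᵐ v ∂lam.toMeasure, Q v) : ∀ᵐ p ∂I.outcome σ, Q p.1.1 := by
  rw [← I.map_outcome_value σ] at h
  exact ae_of_ae_map (measurable_fst.comp measurable_fst).aemeasurable h

lemma ae_bidLaw_apply (σ : I.Profile bmax) (s : ∀ i, I.S i) (i : Fin N) {Q : ℝ → Prop}
    (h : ∀ᵐ x ∂(σ i).kernel (s i), Q x) : ∀ᵐ b ∂I.bidLaw σ s, Q (b i) :=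
  (Measure.tendsto_eval_ae_ae (μ := fun i => (σ i).kernel (s i))).eventually h

lemma ae_bidLaw_mem_Icc (σ : I.Profile bmax) (s : ∀ i, I.S i) :
    ∀ᵐ b ∂I.bidLaw σ s, ∀ i, b i ∈ Set.Icc 0 bmax :=
  ae_all_iff.2 fun i => I.ae_bidLaw_apply σ s i ((σ i).supported (s i))

lemma ae_bid_mem_Icc (σ : I.Profile bmax) :
    ∀ᵐ p ∂I.outcome σ, ∀ i, p.2 i ∈ Set.Icc 0 bmax := by
  unfold outcome
  refine Measure.ae_compProd_of_ae_ae ?_ (Filter.Eventually.of_forall fun p => ?_)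
  · simp only [Set.ofPred_forall]
    exact MeasurableSet.iInter fun i =>
      ((measurable_pi_apply i).comp measurable_snd) measurableSet_Icc
  · exact I.ae_bidLaw_mem_Icc σ p.2

lemma secmax_mem_Icc (hN : 2 ≤ N) {b : Fin N → ℝ} (h : ∀ i, b i ∈ Set.Icc 0 bmax) :
    secmax b ∈ Set.Icc 0 bmax :=
  ⟨secmax_nonneg fun i => (h i).1, secmax_le hN fun i _ _ => (min_le_left _ _).trans (h i).2⟩

lemma measurable_value (i : Fin N) :
    Measurable fun p : ((Fin N → ℝ) × (∀ i, I.S i)) × (Fin N → ℝ) => p.1.1 i :=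
  (measurable_pi_apply i).comp (measurable_fst.comp measurable_fst)

lemma measurable_bid (i : Fin N) :
    Measurable fun p : ((Fin N → ℝ) × (∀ i, I.S i)) × (Fin N → ℝ) => p.2 i :=
  (measurable_pi_apply i).comp measurable_snd

section Bounded

variable (hv : ∀ᵐ v ∂lam.toMeasure, ∀ i, v i ∈ Set.Icc (0 : ℝ) 1) (σ : I.Profile bmax)
include hv

lemma integrable_alloc_mul_value (i j : Fin N) :
    Integrable (fun p => alloc j p.2 * p.1.1 i) (I.outcome σ) := by
  refine Integrable.of_bound (C := 1)
    (((measurable_alloc j).comp measurable_snd).mul (I.measurable_value i)).aestronglyMeasurable ?_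
  filter_upwards [I.ae_outcome_of_ae_value σ hv] with p hp
  rw [Real.norm_eq_abs, abs_of_nonneg (mul_nonneg (alloc_nonneg _ _) (hp i).1)]
  exact mul_le_one₀ (alloc_le_one _ _) (hp i).1 (hp i).2

omit hv in
lemma integrable_secmax (hN : 2 ≤ N) :
    Integrable (fun p => secmax p.2) (I.outcome σ) := by
  refine Integrable.of_bound (C := bmax)
    (measurable_secmax.comp measurable_snd).aestronglyMeasurable ?_
  filter_upwards [I.ae_bid_mem_Icc σ] with p hp
  have := secmax_mem_Icc hN hp
  rw [Real.norm_eq_abs, abs_of_nonneg this.1]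
  exact this.2

omit hv in
lemma integrable_alloc_mul_secmax (hN : 2 ≤ N) (i : Fin N) :
    Integrable (fun p => alloc i p.2 * secmax p.2) (I.outcome σ) := by
  refine (I.integrable_secmax σ hN).mono
    (((measurable_alloc i).comp measurable_snd).mul
      (measurable_secmax.comp measurable_snd)).aestronglyMeasurable ?_
  refine Filter.Eventually.of_forall fun p => ?_
  rw [norm_mul, Real.norm_eq_abs, abs_of_nonneg (alloc_nonneg _ _)]
  exact mul_le_of_le_one_left (norm_nonneg _) (alloc_le_one _ _)

lemma integrable_payoff (hN : 2 ≤ N) (i : Fin N) :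
    Integrable (fun p => alloc i p.2 * (p.1.1 i - secmax p.2)) (I.outcome σ) := by
  simp only [mul_sub]
  exact (I.integrable_alloc_mul_value hv σ i i).sub (I.integrable_alloc_mul_secmax σ hN i)

lemma surplus_eq (hN : 2 ≤ N) (i : Fin N) :
    I.surplus σ i = ∫ p, alloc i p.2 * (p.1.1 i - secmax p.2) ∂I.outcome σ :=
  (Measure.integral_compProd (I.integrable_payoff hv σ hN i)).symm

lemma welfare_eq : I.welfare σ = ∫ p, ∑ i, alloc i p.2 * p.1.1 i ∂I.outcome σ :=
  (Measure.integral_compProd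
    (integrable_finsetSum _ fun i _ => I.integrable_alloc_mul_value hv σ i i)).symm

/-- Bidder surplus is welfare minus revenue. -/
lemma bidderSurplus_eq (hN : 2 ≤ N) :
    I.bidderSurplus σ = I.welfare σ - ∫ p, secmax p.2 ∂I.outcome σ := by
  have hw := integrable_finsetSum Finset.univ
    fun i _ => I.integrable_alloc_mul_value hv σ i i
  rw [bidderSurplus, I.welfare_eq hv σ, ← integral_sub hw (I.integrable_secmax σ hN)]
  simp only [I.surplus_eq hv σ hN]
  rw [← integral_finsetSum _ fun i _ => I.integrable_payoff hv σ hN i]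
  congr 1
  funext p
  simp only [mul_sub, Finset.sum_sub_distrib]
  rw [← Finset.sum_mul, sum_alloc (by omega), one_mul]

omit hv in
lemma maxWelfare_eq : maxWelfare lam = ∫ p, ⨆ i, p.1.1 i ∂I.outcome σ := by
  rw [maxWelfare, ← I.map_outcome_value σ, integral_map]
  · exact (measurable_fst.comp measurable_fst).aemeasurable
  · exact (Measurable.iSup fun i => measurable_pi_apply i).aestronglyMeasurable

lemma integrable_iSup_value (hN : 0 < N) :
    Integrable (fun p => ⨆ i, p.1.1 i) (I.outcome σ) := by
  have : Nonempty (Fin N) := ⟨⟨0, hN⟩⟩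
  refine Integrable.of_bound (C := 1)
    (Measurable.iSup fun i => I.measurable_value i).aestronglyMeasurable ?_
  filter_upwards [I.ae_outcome_of_ae_value σ hv] with p hp
  rw [Real.norm_eq_abs, abs_of_nonneg (Real.iSup_nonneg fun i => (hp i).1)]
  exact ciSup_le fun i => (hp i).2

/-- Efficiency means that almost surely a bidder with the highest value wins. -/
lemma isEfficient_iff (hN : 0 < N) : I.IsEfficient σ ↔
    ∀ᵐ p ∂I.outcome σ, ∑ i, alloc i p.2 * p.1.1 i = ⨆ i, p.1.1 i := by
  rw [IsEfficient, I.welfare_eq hv σ, I.maxWelfare_eq σ]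
  exact integral_eq_iff_of_ae_le
    (integrable_finsetSum _ fun i _ => I.integrable_alloc_mul_value hv σ i i)
    (I.integrable_iSup_value hv σ hN)
    (Filter.Eventually.of_forall fun p => sum_alloc_mul_le hN p.2 p.1.1)

end Bounded

end InfoStructure

/-! ### Constant deviations, and independence of bids -/

/-- The strategy that bids `c` whatever the signal. -/
def Strategy.const (S : Type) [MeasurableSpace S] {bmax : ℝ} (c : ℝ) (hc : c ∈ Set.Icc 0 bmax) :
    Strategy S bmax where
  kernel := Kernel.const S (Measure.dirac c)
  supported s := by
    rw [Kernel.const_apply]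
    exact (ae_dirac_iff (p := fun b => b ∈ Set.Icc 0 bmax) measurableSet_Icc).2 hc

namespace InfoStructure

variable {N : ℕ} {lam : PMF (Fin N → ℝ)} (I : InfoStructure lam) {bmax : ℝ}

/-- This realises a constant deviation on the probability space of the original outcome, so that the
two payoffs can be compared pointwise. -/
lemma bidLaw_update_const (σ : I.Profile bmax) (j : Fin N) {c : ℝ} (hc : c ∈ Set.Icc 0 bmax)
    (s : ∀ i, I.S i) :
    I.bidLaw (Function.update σ j (Strategy.const (I.S j) c hc)) s =
      (I.bidLaw σ s).map fun b => Function.update b j c := by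
  refine Measure.pi_eq (μ := fun i =>
    (Function.update σ j (Strategy.const (I.S j) c hc) i).kernel (s i)) fun A hA => ?_
  rw [Measure.map_apply (measurable_update_left) (MeasurableSet.univ_pi hA)]
  by_cases hcA : c ∈ A j
  · have : (fun b : Fin N → ℝ => Function.update b j c) ⁻¹' Set.univ.pi A =
        Set.univ.pi (Function.update A j Set.univ) := by
      ext b
      simp only [Set.mem_preimage, Set.mem_univ_pi]
      refine forall_congr' fun i => ?_
      by_cases hi : i = j
      · subst hi; simp [hcA]
      · simp [hi]
    rw [this, bidLaw, Measure.pi_pi]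
    refine Finset.prod_congr rfl fun i _ => ?_
    by_cases hi : i = j
    · subst hi
      simp [Strategy.const, hcA, Measure.dirac_apply' _ (hA i)]
    · simp [hi]
  · have : (fun b : Fin N → ℝ => Function.update b j c) ⁻¹' Set.univ.pi A = ∅ := by
      ext b
      simp only [Set.mem_preimage, Set.mem_univ_pi, Set.mem_empty_iff_false, iff_false, not_forall]
      exact ⟨j, by simpa using hcA⟩
    rw [this, measure_empty, eq_comm, Finset.prod_eq_zero (Finset.mem_univ j)]
    simp [Strategy.const, hcA, Measure.dirac_apply' _ (hA j)]

lemma surplus_update_const (hN : 2 ≤ N) (hv : ∀ᵐ v ∂lam.toMeasure, ∀ i, v i ∈ Set.Icc (0 : ℝ) 1)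
    (σ : I.Profile bmax) (j : Fin N) {c : ℝ} (hc : c ∈ Set.Icc 0 bmax) :
    I.surplus (Function.update σ j (Strategy.const (I.S j) c hc)) j =
      ∫ p, alloc j (Function.update p.2 j c) *
        (p.1.1 j - secmax (Function.update p.2 j c)) ∂I.outcome σ := by
  have hm : Measurable fun b : Fin N → ℝ => Function.update b j c := measurable_update_left
  have hout : I.outcome (Function.update σ j (Strategy.const (I.S j) c hc)) =
      (I.outcome σ).map (Prod.map id fun b => Function.update b j c) := by
    rw [outcome, outcome, ← Measure.compProd_map hm]
    congr 1
    ext1 p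
    rw [Kernel.map_apply _ hm, bidKernel_apply, bidKernel_apply, bidLaw_update_const]
  have hi := I.integrable_payoff hv (Function.update σ j (Strategy.const (I.S j) c hc)) hN j
  rw [I.surplus_eq hv _ hN]
  rw [hout] at hi ⊢
  rw [integral_map (measurable_id.prodMap hm).aemeasurable hi.aestronglyMeasurable]
  rfl

/-- Under a private private information structure the bids of two bidders are independent. -/
lemma outcome_bid_indep (hI : I.IsPrivatePrivate) (σ : I.Profile bmax) {i j : Fin N} (hij : i ≠ j)
    {A B : Set ℝ} (hA : MeasurableSet A) (hB : MeasurableSet B) :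
    I.outcome σ {p | p.2 i ∈ A ∧ p.2 j ∈ B} =
      I.outcome σ {p | p.2 i ∈ A} * I.outcome σ {p | p.2 j ∈ B} := by
  classical
  have hmA : Measurable fun s : ∀ i, I.S i => (σ i).kernel (s i) A :=
    ((σ i).kernel.measurable_coe hA).comp (measurable_pi_apply i)
  have hmB : Measurable fun s : ∀ i, I.S i => (σ j).kernel (s j) B :=
    ((σ j).kernel.measurable_coe hB).comp (measurable_pi_apply j)
  have hsA := I.measurable_bid i hA
  have hsB := I.measurable_bid j hB
  -- Given the signals, a box of bids has a probability that factors into functions of separate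
  -- signals; `hI` makes the signals themselves independent.
  have key : ∀ (C : Fin N → Set ℝ), (∀ i, MeasurableSet (C i)) →
      I.outcome σ (Prod.snd ⁻¹' Set.univ.pi C) =
        ∫⁻ s, ∏ k, (σ k).kernel (s k) (C k) ∂(Measure.pi I.signalLaw) := by
    intro C hC
    rw [outcome, Measure.compProd_apply (measurable_snd (MeasurableSet.univ_pi hC)), ← hI,
      lintegral_map _ measurable_snd]
    · refine lintegral_congr fun p => ?_
      rw [bidKernel_apply, ← Set.preimage_comp]
      exact Measure.pi_pi _ _
    · exact Finset.measurable_prod _ fun i _ =>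
        ((σ i).kernel.measurable_coe (hC i)).comp (measurable_pi_apply i)
  have single : ∀ (k : Fin N) (C : Set ℝ), MeasurableSet C → I.outcome σ {p | p.2 k ∈ C} =
      ∫⁻ s, (σ k).kernel (s k) C ∂(Measure.pi I.signalLaw) := by
    intro k C hC
    have h1 : {p : ((Fin N → ℝ) × (∀ i, I.S i)) × (Fin N → ℝ) | p.2 k ∈ C} =
        Prod.snd ⁻¹' Set.univ.pi (Function.update (fun _ => Set.univ) k C) := by
      ext p
      simp only [Set.mem_ofPred_eq, Set.mem_preimage, Set.mem_univ_pi]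
      constructor
      · intro h l
        by_cases hl : l = k
        · subst hl; simpa using h
        · simp [hl]
      · intro h; simpa using h k
    rw [h1, key _ fun l => ?_]
    · refine lintegral_congr fun s => ?_
      rw [Finset.prod_eq_single k]
      · simp
      · intro l _ hl; simp [hl]
      · simp
    · by_cases hl : l = k
      · subst hl; simpa using hC
      · simp [hl]
  have h2 : {p : ((Fin N → ℝ) × (∀ i, I.S i)) × (Fin N → ℝ) | p.2 i ∈ A ∧ p.2 j ∈ B} =
      Prod.snd ⁻¹' Set.univ.pi
        (Function.update (Function.update (fun _ => Set.univ) i A) j B) := by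
    ext p
    simp only [Set.mem_ofPred_eq, Set.mem_preimage, Set.mem_univ_pi]
    constructor
    · rintro ⟨h, h'⟩ l
      by_cases hl : l = j
      · subst hl; simpa using h'
      by_cases hl' : l = i
      · subst hl'; simpa [hl] using h
      · simp [hl, hl']
    · intro h; exact ⟨by simpa [hij] using h i, by simpa using h j⟩
  rw [h2, single i A hA, single j B hB, key _ fun l => ?_]
  · have hind : IndepFun (fun s : ∀ i, I.S i => (σ i).kernel (s i) A)
        (fun s => (σ j).kernel (s j) B) (Measure.pi I.signalLaw) := by
      have := (iIndepFun_pi (μ := I.signalLaw) (X := fun k (x : I.S k) => x)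
        fun k => aemeasurable_id).indepFun hij
      exact this.comp ((σ i).kernel.measurable_coe hA) ((σ j).kernel.measurable_coe hB)
    rw [← lintegral_mul_eq_lintegral_mul_lintegral_of_indepFun hmA hmB hind]
    refine lintegral_congr fun s => ?_
    rw [Finset.prod_eq_mul i j hij]
    · simp [hij]
    · rintro l _ ⟨hl, hl'⟩; simp [hl, hl']
    · simp
    · simp
  · by_cases hl : l = j
    · subst hl; simpa using hB
    by_cases hl' : l = i
    · subst hl'; simpa [hl] using hA
    · simp [hl, hl']

end InfoStructure

/-! ### Necessity: what little revenue implies about the support -/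

lemma alloc_mul_secmax_le {N : ℕ} (hN : 2 ≤ N) {i : Fin N} {b : Fin N → ℝ} (hb : 0 ≤ b i) :
    alloc i b * secmax b ≤ b i := by
  obtain ⟨m, hm, k, hk, rfl⟩ := exists_max_others hN i b
  rw [alloc_mul_secmax hN hm ⟨k, hk, rfl⟩]
  rcases lt_or_ge (b i) (b k) with h | h
  · rw [alloc_eq_zero h, zero_mul]; exact hb
  · calc alloc i b * b k ≤ alloc i b * b i := mul_le_mul_of_nonneg_left h (alloc_nonneg _ _)
      _ ≤ b i := mul_le_of_le_one_left hb (alloc_le_one _ _)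

lemma ae_mem_support {α : Type*} [MeasurableSpace α] [MeasurableSingletonClass α] (P : PMF α) :
    ∀ᵐ a ∂P.toMeasure, a ∈ P.support := by
  have hm : MeasurableSet P.supportᶜ := P.support_countable.measurableSet.compl
  exact (PMF.toMeasure_apply_eq_zero_iff P hm).2 disjoint_compl_right

namespace InfoStructure

variable {N : ℕ} {lam : PMF (Fin N → ℝ)} (I : InfoStructure lam) {bmax : ℝ}

/-- The value that bidder `j` forgoes by not winning when all other bids are at most `t`. -/
def forgone (t : ℝ) (j : Fin N) (p : ((Fin N → ℝ) × (∀ i, I.S i)) × (Fin N → ℝ)) : ℝ :=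
  {p : ((Fin N → ℝ) × (∀ i, I.S i)) × (Fin N → ℝ) | ∀ k, k ≠ j → p.2 k ≤ t}.indicator
    (fun p => p.1.1 j - alloc j p.2 * p.1.1 j) p

lemma measurableSet_others_le (t : ℝ) (j : Fin N) : MeasurableSet
    {p : ((Fin N → ℝ) × (∀ i, I.S i)) × (Fin N → ℝ) | ∀ k, k ≠ j → p.2 k ≤ t} := by
  simp only [Set.ofPred_forall]
  exact MeasurableSet.iInter fun k => MeasurableSet.iInter fun _ =>
    I.measurable_bid k measurableSet_Iic

lemma integrable_value (hv : ∀ᵐ v ∂lam.toMeasure, ∀ i, v i ∈ Set.Icc (0 : ℝ) 1)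
    (σ : I.Profile bmax) (j : Fin N) : Integrable (fun p => p.1.1 j) (I.outcome σ) := by
  refine Integrable.of_bound (C := 1) (I.measurable_value j).aestronglyMeasurable ?_
  filter_upwards [I.ae_outcome_of_ae_value σ hv] with p hp
  rw [Real.norm_eq_abs, abs_of_nonneg (hp j).1]
  exact (hp j).2

lemma integrable_forgone (hv : ∀ᵐ v ∂lam.toMeasure, ∀ i, v i ∈ Set.Icc (0 : ℝ) 1)
    (σ : I.Profile bmax) (t : ℝ) (j : Fin N) : Integrable (I.forgone t j) (I.outcome σ) :=
  ((I.integrable_value hv σ j).sub (I.integrable_alloc_mul_value hv σ j j)).indicator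
    (I.measurableSet_others_le t j)

/-- The deviation to `2 * t` gains the forgone value at a price of at most `2 * t`. Its only other
cost is value won at present against some bid above `t`, and such wins are rare because they
generate revenue. -/
lemma integral_forgone_le (hN : 2 ≤ N)
    (hv : ∀ᵐ v ∂lam.toMeasure, ∀ i, v i ∈ Set.Icc (0 : ℝ) 1) (σ : I.Profile bmax)
    (hσ : I.IsBNE σ) {t : ℝ} (ht : 0 < t) (htb : 2 * t ≤ bmax) (j : Fin N) :
    ∫ p, I.forgone t j p ∂I.outcome σ ≤ 2 * t + (∫ p, secmax p.2 ∂I.outcome σ) / t := by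
  have hc : 2 * t ∈ Set.Icc 0 bmax := ⟨by positivity, htb⟩
  have hdev := hσ j (Strategy.const (I.S j) (2 * t) hc)
  rw [I.surplus_update_const hN hv σ j hc, I.surplus_eq hv σ hN j] at hdev
  have hm : Measurable fun b : Fin N → ℝ => Function.update b j (2 * t) := measurable_update_left
  have hint : Integrable (fun p => alloc j (Function.update p.2 j (2 * t)) *
      (p.1.1 j - secmax (Function.update p.2 j (2 * t)))) (I.outcome σ) := by
    refine Integrable.of_bound (C := 1 + bmax)
      (((measurable_alloc j).comp (hm.comp measurable_snd)).mul ((I.measurable_value j).sub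
        (measurable_secmax.comp (hm.comp measurable_snd)))).aestronglyMeasurable ?_
    filter_upwards [I.ae_outcome_of_ae_value σ hv, I.ae_bid_mem_Icc σ] with p hp hb
    have hb' : ∀ i, Function.update p.2 j (2 * t) i ∈ Set.Icc 0 bmax := by
      intro i
      by_cases hi : i = j
      · subst hi; simpa using hc
      · simpa [hi] using hb i
    have hs := secmax_mem_Icc hN hb'
    rw [norm_mul, Real.norm_eq_abs, abs_of_nonneg (alloc_nonneg _ _)]
    refine (mul_le_of_le_one_left (norm_nonneg _) (alloc_le_one _ _)).trans ?_
    rw [Real.norm_eq_abs, abs_le]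
    constructor <;> linarith [hs.1, hs.2, (hp j).1, (hp j).2]
  have hpay := I.integrable_payoff hv σ hN j
  have hsec := (I.integrable_secmax σ hN).div_const t
  have hle : ∫ p, I.forgone t j p ∂I.outcome σ ≤
      ∫ p, (alloc j (Function.update p.2 j (2 * t)) *
        (p.1.1 j - secmax (Function.update p.2 j (2 * t))) -
        alloc j p.2 * (p.1.1 j - secmax p.2)) + (2 * t + secmax p.2 / t) ∂I.outcome σ := by
    refine integral_mono_ae (I.integrable_forgone hv σ t j)
      ((hint.sub hpay).add ((integrable_const _).add hsec)) ?_
    filter_upwards [I.ae_outcome_of_ae_value σ hv, I.ae_bid_mem_Icc σ] with p hp hb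
    have hsu : alloc j (Function.update p.2 j (2 * t)) *
        secmax (Function.update p.2 j (2 * t)) ≤ 2 * t := by
      have := alloc_mul_secmax_le hN (i := j) (b := Function.update p.2 j (2 * t))
        (by simpa using ht.le)
      simpa using this
    have hs := secmax_nonneg fun i => (hb i).1
    have hs' : 0 ≤ alloc j p.2 * secmax p.2 := mul_nonneg (alloc_nonneg _ _) hs
    have hst : 0 ≤ secmax p.2 / t := by positivity
    have hvj := hp j
    by_cases hE : ∀ k, k ≠ j → p.2 k ≤ t
    · have h1 : alloc j (Function.update p.2 j (2 * t)) = 1 := by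
        refine alloc_eq_one fun k hk => ?_
        simp only [Function.update_self, ne_eq, hk, not_false_eq_true, Function.update_of_ne]
        linarith [hE k hk]
      rw [forgone, Set.indicator_of_mem (by exact hE)]
      rw [h1] at hsu ⊢
      linarith
    · have h0 : 0 ≤ alloc j (Function.update p.2 j (2 * t)) * p.1.1 j :=
        mul_nonneg (alloc_nonneg _ _) hvj.1
      rw [forgone, Set.indicator_of_notMem (by exact hE)]
      -- If `j` wins while another bid exceeds `t`, so does the second highest bid, whereas the
      -- value is at most `1`.
      have h1 : alloc j p.2 * p.1.1 j ≤ secmax p.2 / t := by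
        push Not at hE
        obtain ⟨k, hk, hkt⟩ := hE
        rcases lt_or_ge (p.2 j) (p.2 k) with h | h
        · rw [alloc_eq_zero h, zero_mul]; exact hst
        · refine (mul_le_one₀ (alloc_le_one _ _) hvj.1 hvj.2).trans ?_
          rw [le_div_iff₀ ht, one_mul]
          have := min_le_secmax p.2 hk
          rw [min_eq_left h] at this
          linarith
      linarith
  have e1 : ∫ p, (alloc j (Function.update p.2 j (2 * t)) *
        (p.1.1 j - secmax (Function.update p.2 j (2 * t))) -
        alloc j p.2 * (p.1.1 j - secmax p.2)) + (2 * t + secmax p.2 / t) ∂I.outcome σ =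
      (∫ p, alloc j (Function.update p.2 j (2 * t)) *
        (p.1.1 j - secmax (Function.update p.2 j (2 * t))) ∂I.outcome σ -
        ∫ p, alloc j p.2 * (p.1.1 j - secmax p.2) ∂I.outcome σ) +
      (2 * t + (∫ p, secmax p.2 ∂I.outcome σ) / t) := by
    have e2 : ∫ p, 2 * t + secmax p.2 / t ∂I.outcome σ =
        2 * t + (∫ p, secmax p.2 ∂I.outcome σ) / t := by
      rw [integral_add (integrable_const _) hsec, integral_div, integral_const]
      simp
    rw [← integral_sub hint hpay, ← e2]
    exact integral_add (hint.sub hpay) ((integrable_const _).add hsec)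
  linarith

/-- With independent bids and a small second highest bid, all bidders but one mostly bid low. -/
lemma exists_others_low (hN : 2 ≤ N) (hI : I.IsPrivatePrivate) (σ : I.Profile bmax) {t : ℝ}
    (ht : 0 < t) (hrev : ∫ p, secmax p.2 ∂I.outcome σ ≤ t ^ 3) :
    ∃ e : Fin N, (I.outcome σ).real {p | ∀ k, k ≠ e → p.2 k ≤ t}ᶜ ≤ N * t := by
  classical
  have : Nonempty (Fin N) := ⟨⟨0, by omega⟩⟩
  -- With `e` the bidder most likely to exceed `t`, the square of any other bidder's probability is
  -- at most the product of the two, hence at most `t ^ 2`.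
  obtain ⟨e, he⟩ := Finite.exists_max fun i => (I.outcome σ).real {p | p.2 i ∈ Set.Ioi t}
  have hlow : ∀ k, k ≠ e → (I.outcome σ).real {p | p.2 k ∈ Set.Ioi t} ≤ t := by
    intro k hk
    have hprod : (I.outcome σ).real {p | p.2 k ∈ Set.Ioi t} *
        (I.outcome σ).real {p | p.2 e ∈ Set.Ioi t} ≤ t ^ 2 := by
      have h1 := I.outcome_bid_indep hI σ hk (measurableSet_Ioi (a := t))
        (measurableSet_Ioi (a := t))
      have h2 : t * (I.outcome σ).real {p | t ≤ secmax p.2} ≤ t ^ 3 := by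
        refine le_trans (mul_meas_ge_le_integral_of_nonneg ?_ (I.integrable_secmax σ hN) t) hrev
        filter_upwards [I.ae_bid_mem_Icc σ] with p hp
        exact secmax_nonneg fun i => (hp i).1
      have h3 : (I.outcome σ).real {p | p.2 k ∈ Set.Ioi t ∧ p.2 e ∈ Set.Ioi t} ≤
          (I.outcome σ).real {p | t ≤ secmax p.2} :=
        measureReal_mono fun p hp =>
          (le_min (le_of_lt hp.1) (le_of_lt hp.2)).trans (min_le_secmax p.2 hk)
      rw [Measure.real, h1, ENNReal.toReal_mul] at h3
      refine h3.trans ?_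
      refine le_of_mul_le_mul_left ?_ ht
      calc _ ≤ t ^ 3 := h2
        _ = t * t ^ 2 := by ring
    have h0 : 0 ≤ (I.outcome σ).real {p | p.2 k ∈ Set.Ioi t} := measureReal_nonneg
    have := he k
    nlinarith
  refine ⟨e, ?_⟩
  calc (I.outcome σ).real {p | ∀ k, k ≠ e → p.2 k ≤ t}ᶜ
      ≤ (I.outcome σ).real
        (⋃ k ∈ Finset.univ.filter (· ≠ e), {p | p.2 k ∈ Set.Ioi t}) := by
        refine measureReal_mono (fun p hp => ?_) (measure_ne_top _ _)
        simp only [Set.mem_compl_iff, Set.mem_ofPred_eq, not_forall, not_le] at hp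
        obtain ⟨k, hk, hkt⟩ := hp
        simp only [Set.mem_iUnion]
        exact ⟨k, by simpa using hk, hkt⟩
    _ ≤ ∑ k ∈ Finset.univ.filter (· ≠ e), (I.outcome σ).real {p | p.2 k ∈ Set.Ioi t} :=
        measureReal_biUnion_finset_le _ _
    _ ≤ ∑ k ∈ Finset.univ.filter (· ≠ e), t :=
        Finset.sum_le_sum fun k hk => hlow k (by simpa using hk)
    _ ≤ N * t := by
        rw [Finset.sum_const, nsmul_eq_mul]
        refine mul_le_mul_of_nonneg_right ?_ ht.le
        exact_mod_cast (Finset.card_le_univ _).trans_eq (Fintype.card_fin N)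

/-- An efficient equilibrium with little revenue leaves little room for value profiles in which
a bidder with less than the highest value faces at least two positive values. -/
lemma excess_mul_prob_le (hN : 2 ≤ N)
    (hv : ∀ᵐ v ∂lam.toMeasure, ∀ i, v i ∈ Set.Icc (0 : ℝ) 1) (hI : I.IsPrivatePrivate)
    (σ : I.Profile bmax) (hσ : I.IsBNE σ) (heff : I.IsEfficient σ) {t : ℝ} (ht : 0 < t)
    (htb : 2 * t ≤ bmax) (hrev : ∫ p, secmax p.2 ∂I.outcome σ ≤ t ^ 3) :
    ∃ e : Fin N, ∀ v : Fin N → ℝ, (∀ i, v i ∈ Set.Icc (0 : ℝ) 1) → v e < ⨆ i, v i →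
      (∑ i, v i - ⨆ i, v i) * ((lam v).toReal - N * t) ≤ N * (2 * t + t ^ 2) := by
  have : Nonempty (Fin N) := ⟨⟨0, by omega⟩⟩
  obtain ⟨e, he⟩ := I.exists_others_low hN hI σ ht hrev
  refine ⟨e, fun v hv01 hve => ?_⟩
  set G := ∑ i, v i - ⨆ i, v i with hG
  have hG0 : 0 ≤ G := by
    obtain ⟨m, hm⟩ := exists_eq_ciSup_of_finite (f := v)
    rw [hG, ← hm, sub_nonneg]
    exact Finset.single_le_sum (fun i _ => (hv01 i).1) (Finset.mem_univ m)
  set A := {p : ((Fin N → ℝ) × (∀ i, I.S i)) × (Fin N → ℝ) | p.1.1 = v} with hA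
  set B := {p : ((Fin N → ℝ) × (∀ i, I.S i)) × (Fin N → ℝ) | ∀ k, k ≠ e → p.2 k ≤ t} with hB
  have hmA : MeasurableSet A :=
    (measurable_fst.comp measurable_fst) (measurableSet_singleton v)
  have hmB : MeasurableSet B := I.measurableSet_others_le t e
  have hPA : (I.outcome σ).real A = (lam v).toReal := by
    rw [Measure.real, ← lam.toMeasure_apply_singleton v (measurableSet_singleton v),
      ← I.map_outcome_value σ]
    exact congrArg ENNReal.toReal (Measure.map_apply (measurable_fst.comp measurable_fst)
      (measurableSet_singleton v)).symm
  have hiA : Integrable (A.indicator (1 : ((Fin N → ℝ) × (∀ i, I.S i)) × (Fin N → ℝ) → ℝ)) (I.outcome σ) :=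
    (integrable_const (1 : ℝ)).indicator hmA
  have hiB : Integrable (Bᶜ.indicator (1 : ((Fin N → ℝ) × (∀ i, I.S i)) × (Fin N → ℝ) → ℝ)) (I.outcome σ) :=
    (integrable_const (1 : ℝ)).indicator hmB.compl
  -- The difference of the indicators of `A` and `Bᶜ` is at most `0` off `A ∩ B`, where
  -- nonnegativity of the forgone values suffices. On `A ∩ B` all bids turn out to be at most `t`,
  -- and the forgone values sum to `G`.
  have hsum : G * ((I.outcome σ).real A - (I.outcome σ).real Bᶜ) ≤
      ∫ p, ∑ j, I.forgone t j p ∂I.outcome σ := by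
    rw [← integral_indicator_one hmA, ← integral_indicator_one hmB.compl,
      ← integral_sub hiA hiB, ← integral_const_mul]
    refine integral_mono_ae ((hiA.sub hiB).const_mul G)
      (integrable_finsetSum _ fun j _ => I.integrable_forgone hv σ t j) ?_
    filter_upwards [I.ae_outcome_of_ae_value σ hv,
      (I.isEfficient_iff hv σ (by omega)).1 heff] with p hp hpe
    have hnn : ∀ j, 0 ≤ I.forgone t j p := fun j => by
      exact Set.indicator_apply_nonneg fun _ =>
        sub_nonneg.2 (mul_le_of_le_one_left (hp j).1 (alloc_le_one j p.2))
    by_cases hpA : p ∈ A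
    · by_cases hpB : p ∈ B
      · have hpv : p.1.1 = v := hpA
        rw [hpv] at hpe
        have hae : alloc e p.2 = 0 := by
          by_contra hne
          have hlt : ∑ i, alloc i p.2 * v i < ∑ i, alloc i p.2 * ⨆ i, v i :=
            Finset.sum_lt_sum (fun i _ => mul_le_mul_of_nonneg_left
              (le_ciSup (Set.finite_range v).bddAbove i) (alloc_nonneg _ _))
              ⟨e, Finset.mem_univ e,
                mul_lt_mul_of_pos_left hve ((alloc_nonneg e p.2).lt_of_ne' hne)⟩
          rw [← Finset.sum_mul, sum_alloc (by omega), one_mul, hpe] at hlt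
          exact lt_irrefl _ hlt
        -- A bid of `e` above `t` would win outright, against efficiency.
        have hbe : p.2 e ≤ t := by
          by_contra hbe
          push Not at hbe
          rw [alloc_eq_one fun j hj => (hpB j hj).trans_lt hbe] at hae
          exact one_ne_zero hae
        have hall : ∀ k, p.2 k ≤ t := fun k => by
          by_cases hk : k = e
          · rwa [hk]
          · exact hpB k hk
        have : ∑ j, I.forgone t j p = G := by
          rw [hG, ← hpe, ← Finset.sum_sub_distrib]
          refine Finset.sum_congr rfl fun j _ => ?_
          rw [forgone, Set.indicator_of_mem (by exact fun k _ => hall k), hpv]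
        rw [this]
        simp [hpA, hpB]
      · have : G * (A.indicator 1 p - Bᶜ.indicator 1 p) = 0 := by simp [hpA, hpB]
        exact this.trans_le (Finset.sum_nonneg fun j _ => hnn j)
    · have : G * (A.indicator 1 p - Bᶜ.indicator 1 p) ≤ 0 := by
        refine mul_nonpos_of_nonneg_of_nonpos hG0 ?_
        rw [Set.indicator_of_notMem hpA, zero_sub, neg_nonpos]
        exact Set.indicator_nonneg (fun _ _ => zero_le_one) _
      exact this.trans (Finset.sum_nonneg fun j _ => hnn j)
  rw [integral_finsetSum _ fun j _ => I.integrable_forgone hv σ t j, hPA] at hsum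
  calc G * ((lam v).toReal - N * t)
      ≤ G * ((lam v).toReal - (I.outcome σ).real Bᶜ) :=
        mul_le_mul_of_nonneg_left (by linarith) hG0
    _ ≤ _ := hsum
    _ ≤ ∑ j : Fin N, (2 * t + t ^ 2) := by
        refine Finset.sum_le_sum fun j _ => ?_
        refine (I.integral_forgone_le hN hv σ hσ ht htb j).trans ?_
        gcongr
        rw [div_le_iff₀ ht]
        linarith [hrev, (by ring : t ^ 2 * t = t ^ 3)]
    _ = N * (2 * t + t ^ 2) := by rw [Finset.sum_const, Finset.card_fin, nsmul_eq_mul]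

end InfoStructure

/-- If efficient equilibria with arbitrarily little revenue exist, then every value profile in the
support has equal values or only one positive value. -/
lemma eq_or_single_of_exists {N : ℕ} (hN : 2 ≤ N) {vmax : ℝ} {lam : PMF (Fin N → ℝ)}
    (hv : ∀ v ∈ lam.support, ∀ i, v i ∈ Set.Icc (0 : ℝ) 1 ∧ v i ≤ vmax)
    (hsymm : ∀ (τ : Equiv.Perm (Fin N)) (v : Fin N → ℝ), lam (v ∘ τ) = lam v)
    (h : ∀ ε : ℝ, 0 < ε → ∃ I : InfoStructure lam, I.IsPrivatePrivate ∧ ∃ σ : I.Profile vmax,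
      I.NoOverbidding σ ∧ I.IsBNE σ ∧ I.IsEfficient σ ∧ maxWelfare lam - ε ≤ I.bidderSurplus σ)
    {v : Fin N → ℝ} (hvs : v ∈ lam.support) :
    (∀ i j, v i = v j) ∨ ∃ i, 0 < v i ∧ ∀ j, j ≠ i → v j = 0 := by
  have : Nonempty (Fin N) := ⟨⟨0, by omega⟩⟩
  by_contra hbad
  push Not at hbad
  obtain ⟨hne, hsing⟩ := hbad
  have hae : ∀ᵐ v ∂lam.toMeasure, ∀ i, v i ∈ Set.Icc (0 : ℝ) 1 := by
    filter_upwards [ae_mem_support lam] with v hv' i using (hv v hv' i).1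
  obtain ⟨m, hm⟩ := exists_eq_ciSup_of_finite (f := v)
  have hle : ∀ i, v i ≤ ⨆ i, v i := le_ciSup (Set.finite_range v).bddAbove
  obtain ⟨a, ha⟩ : ∃ a, v a < ⨆ i, v i := by
    by_contra! hcon
    obtain ⟨i, j, hij⟩ := hne
    exact hij (((hle i).antisymm (hcon i)).trans ((hle j).antisymm (hcon j)).symm)
  have hmpos : 0 < v m := by
    rw [hm]; exact (hv v hvs a).1.1.trans_lt ha
  obtain ⟨k, hkm, hk0⟩ := hsing m hmpos
  have hkpos : 0 < v k := (hv v hvs k).1.1.lt_of_ne' hk0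
  have hGpos : 0 < ∑ i, v i - ⨆ i, v i := by
    rw [← hm, sub_pos]
    have := Finset.add_le_sum (s := Finset.univ) (f := v) (i := m) (j := k)
      (fun i _ => (hv v hvs i).1.1) (Finset.mem_univ _) (Finset.mem_univ _) hkm.symm
    linarith
  set G := ∑ i, v i - ⨆ i, v i with hG
  have hlpos : 0 < (lam v).toReal :=
    ENNReal.toReal_pos ((PMF.mem_support_iff _ _).1 hvs) (lam.apply_ne_top v)
  have hGN : G ≤ N := by
    have h1 : ∑ i, v i ≤ N := by
      calc ∑ i, v i ≤ ∑ i : Fin N, (1 : ℝ) := Finset.sum_le_sum fun i _ => (hv v hvs i).1.2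
        _ = N := by simp
    linarith [hle m]
  have hmax : 0 < vmax := hmpos.trans_le (hv v hvs m).2
  have hN0 : (0 : ℝ) < N := by exact_mod_cast (by omega : 0 < N)
  -- Since `G ≤ N` and `t ≤ 1`, the bound of `excess_mul_prob_le` yields `G * lam v ≤ t * (N * N + 3
  -- * N)`, which is half of `t * K`; so `t * K ≤ G * lam v` is contradictory.
  set K : ℝ := 2 * (N * N + 3 * N) with hK
  have hKpos : 0 < K := by positivity
  set t := min 1 (min (vmax / 2) (G * (lam v).toReal / K)) with ht
  have htpos : 0 < t := by
    refine lt_min one_pos (lt_min (by linarith) (by positivity))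
  have ht1 : t ≤ 1 := min_le_left _ _
  have ht2 : t ≤ vmax / 2 := (min_le_right _ _).trans (min_le_left _ _)
  have ht3 : t * K ≤ G * (lam v).toReal := by
    rw [← le_div_iff₀ hKpos]
    exact (min_le_right _ _).trans (min_le_right _ _)
  obtain ⟨I, hI, σ, -, hσ, heff, hbs⟩ := h (t ^ 3) (by positivity)
  have hrev : ∫ p, secmax p.2 ∂I.outcome σ ≤ t ^ 3 := by
    rw [I.bidderSurplus_eq hae σ hN, heff] at hbs
    linarith
  obtain ⟨e, he⟩ := I.excess_mul_prob_le hN hae hI σ hσ heff htpos (by linarith) hrev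
  -- The bidder `e` depends on the equilibrium; exchangeability moves the low value `v a` to her.
  have hsw := he (v ∘ Equiv.swap a e) (fun i => (hv v hvs _).1) ?_
  · have e1 : ∑ i, (v ∘ Equiv.swap a e) i = ∑ i, v i := Equiv.sum_comp (Equiv.swap a e) v
    have e2 : ⨆ i, (v ∘ Equiv.swap a e) i = ⨆ i, v i := (Equiv.swap a e).iSup_comp (g := v)
    rw [e1, e2, hsymm, ← hG] at hsw
    have h1 : G * (N * t) ≤ N * (N * t) := mul_le_mul_of_nonneg_right hGN (by positivity)
    have h2 : N * t ^ 2 ≤ N * t := by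
      refine mul_le_mul_of_nonneg_left ?_ hN0.le
      nlinarith
    have h3 : 0 < t * (N * N + 3 * N) := by positivity
    rw [hK] at ht3
    nlinarith
  · have e2 : ⨆ i, (v ∘ Equiv.swap a e) i = ⨆ i, v i := (Equiv.swap a e).iSup_comp (g := v)
    rw [e2]
    simpa using ha

/-! ### Information structures with binary signals, and pure bids -/

/-- A conditional law of binary signals given the values, as a density in the values. -/
structure SignalDensity {N : ℕ} (lam : PMF (Fin N → ℝ)) where
  dens : (Fin N → Bool) → (Fin N → ℝ) → ℝ
  measurable_dens : ∀ s, Measurable (dens s)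
  nonneg : ∀ s v, 0 ≤ dens s v
  sum_eq : ∀ᵐ v ∂lam.toMeasure, ∑ s, dens s v = 1

/-- The pure strategy bidding `bid s` at signal `s`. -/
def Strategy.pure {bmax : ℝ} (bid : Bool → ℝ) (h : ∀ t, bid t ∈ Set.Icc 0 bmax) :
    Strategy Bool bmax where
  kernel := Kernel.deterministic bid (measurable_of_finite bid)
  supported s := by
    rw [Kernel.deterministic_apply, ae_dirac_eq]
    exact h s

namespace SignalDensity

variable {N : ℕ} {lam : PMF (Fin N → ℝ)} (G : SignalDensity lam)

/-- The joint law of values and signals. -/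
def law : Measure ((Fin N → ℝ) × (Fin N → Bool)) :=
  ∑ s, (lam.toMeasure.withDensity fun v => ENNReal.ofReal (G.dens s v)).map fun v => (v, s)

lemma measurable_ofReal_dens (s : Fin N → Bool) :
    Measurable fun v => ENNReal.ofReal (G.dens s v) :=
  (G.measurable_dens s).ennreal_ofReal

lemma dens_le_one (s : Fin N → Bool) : ∀ᵐ v ∂lam.toMeasure, G.dens s v ≤ 1 := by
  filter_upwards [G.sum_eq] with v hv
  rw [← hv]
  exact Finset.single_le_sum (fun s _ => G.nonneg s v) (Finset.mem_univ s)

lemma law_map_fst : G.law.map Prod.fst = lam.toMeasure := by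
  ext A hA
  rw [Measure.map_apply measurable_fst hA, law, Measure.finsetSum_apply]
  have h1 : ∀ s ∈ (Finset.univ : Finset (Fin N → Bool)),
      ((lam.toMeasure.withDensity fun v => ENNReal.ofReal (G.dens s v)).map fun v => (v, s))
        (Prod.fst ⁻¹' A) = ∫⁻ v in A, ENNReal.ofReal (G.dens s v) ∂lam.toMeasure := by
    intro s _
    rw [Measure.map_apply measurable_prodMk_right (measurable_fst hA),
      ← withDensity_apply _ hA]
    rfl
  rw [Finset.sum_congr rfl h1, ← lintegral_finsetSum _ fun s _ => G.measurable_ofReal_dens s]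
  have h2 : ∀ᵐ v ∂lam.toMeasure.restrict A, ∑ s, ENNReal.ofReal (G.dens s v) = 1 := by
    filter_upwards [ae_restrict_of_ae G.sum_eq] with v hv
    rw [← ENNReal.ofReal_sum_of_nonneg fun s _ => G.nonneg s v, hv, ENNReal.ofReal_one]
  rw [lintegral_congr_ae h2]
  simp

/-- The information structure with binary signals defined by a signal density. -/
@[reducible]
def info : InfoStructure lam where
  S _ := Bool
  law := G.law
  marginal := G.law_map_fst

instance : IsProbabilityMeasure G.law := by
  constructor
  have h : G.law.map Prod.fst Set.univ = 1 := by rw [G.law_map_fst]; exact measure_univ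
  rwa [Measure.map_apply measurable_fst MeasurableSet.univ] at h

/-- The probability of a signal profile. -/
def prob (s : Fin N → Bool) : ℝ := ∫ v, G.dens s v ∂lam.toMeasure

/-- The expected value of bidder `i` on the event that `s` is the signal profile. -/
def mean (s : Fin N → Bool) (i : Fin N) : ℝ := ∫ v, G.dens s v * v i ∂lam.toMeasure

lemma prob_nonneg (s : Fin N → Bool) : 0 ≤ G.prob s :=
  integral_nonneg fun v => G.nonneg s v

lemma integrable_dens (s : Fin N → Bool) : Integrable (G.dens s) lam.toMeasure := by
  refine Integrable.of_bound (C := 1) (G.measurable_dens s).aestronglyMeasurable ?_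
  filter_upwards [G.dens_le_one s] with v hv
  rwa [Real.norm_eq_abs, abs_of_nonneg (G.nonneg s v)]

lemma integrable_dens_mul (hv : ∀ᵐ v ∂lam.toMeasure, ∀ i, v i ∈ Set.Icc (0 : ℝ) 1)
    (s : Fin N → Bool) (i : Fin N) :
    Integrable (fun v => G.dens s v * v i) lam.toMeasure := by
  refine (G.integrable_dens s).mono
    ((G.measurable_dens s).mul (measurable_pi_apply i)).aestronglyMeasurable ?_
  filter_upwards [hv] with v hv'
  rw [norm_mul]
  refine mul_le_of_le_one_right (norm_nonneg _) ?_
  rw [Real.norm_eq_abs, abs_of_nonneg (hv' i).1]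
  exact (hv' i).2

lemma ae_law {Q : (Fin N → ℝ) × (Fin N → Bool) → Prop}
    (h : ∀ s, ∀ᵐ v ∂lam.toMeasure, 0 < G.dens s v → Q (v, s)) : ∀ᵐ p ∂G.law, Q p := by
  rw [law, ae_iff, Measure.finsetSum_apply, Finset.sum_eq_zero]
  intro s _
  have hme : MeasurableEmbedding fun v : Fin N → ℝ => (v, s) :=
    measurableEmbedding_prod_mk_right s
  rw [hme.map_apply]
  have := (ae_withDensity_iff (G.measurable_ofReal_dens s)).2
    ((h s).mono fun v hv (hne : ENNReal.ofReal (G.dens s v) ≠ 0) =>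
      hv (by simpa using hne))
  exact this

lemma integral_law {F : (Fin N → ℝ) × (Fin N → Bool) → ℝ} (hF : Integrable F G.law) :
    ∫ p, F p ∂G.law = ∑ s, ∫ v, G.dens s v * F (v, s) ∂lam.toMeasure := by
  have hF' := hF
  rw [law, integrable_finsetSum_measure] at hF'
  rw [law, integral_finsetSum_measure hF']
  refine Finset.sum_congr rfl fun s _ => ?_
  have hme : MeasurableEmbedding fun v : Fin N → ℝ => (v, s) :=
    measurableEmbedding_prod_mk_right s
  rw [hme.integral_map, integral_withDensity_eq_integral_toReal_smul
    (G.measurable_ofReal_dens s) (Filter.Eventually.of_forall fun v => ENNReal.ofReal_lt_top)]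
  refine integral_congr_ae (Filter.Eventually.of_forall fun v => ?_)
  simp only [smul_eq_mul]
  rw [ENNReal.toReal_ofReal (G.nonneg s v)]

lemma law_map_snd_singleton (s : Fin N → Bool) :
    G.law.map Prod.snd {s} = ENNReal.ofReal (G.prob s) := by
  classical
  rw [Measure.map_apply measurable_snd (measurableSet_singleton s), law,
    Measure.finsetSum_apply, Finset.sum_eq_single s]
  · rw [Measure.map_apply measurable_prodMk_right (measurable_snd (measurableSet_singleton s))]
    have : (fun v : Fin N → ℝ => (v, s)) ⁻¹' (Prod.snd ⁻¹' {s}) = Set.univ := by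
      ext v; simp
    rw [this, withDensity_apply _ MeasurableSet.univ, Measure.restrict_univ, prob,
      ofReal_integral_eq_lintegral_ofReal (G.integrable_dens s)
        (Filter.Eventually.of_forall (G.nonneg s))]
  · intro s' _ hs'
    rw [Measure.map_apply measurable_prodMk_right (measurable_snd (measurableSet_singleton s))]
    have : (fun v : Fin N → ℝ => (v, s')) ⁻¹' (Prod.snd ⁻¹' {s}) = ∅ := by
      ext v; simp [hs']
    rw [this, measure_empty]
  · simp

/-- The law on `Bool` with weights `r`. -/
def boolLaw (r : Bool → ℝ) : Measure Bool :=
  ENNReal.ofReal (r true) • Measure.dirac true + ENNReal.ofReal (r false) • Measure.dirac false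

lemma boolLaw_singleton (r : Bool → ℝ) (t : Bool) : boolLaw r {t} = ENNReal.ofReal (r t) := by
  cases t <;> simp [boolLaw]

lemma isProbabilityMeasure_boolLaw {r : Bool → ℝ} (h0 : ∀ t, 0 ≤ r t)
    (h1 : r true + r false = 1) : IsProbabilityMeasure (boolLaw r) := by
  constructor
  simp [boolLaw, ← ENNReal.ofReal_add (h0 true) (h0 false), h1]

section Product

variable {r : Fin N → Bool → ℝ} (h0 : ∀ i t, 0 ≤ r i t) (h1 : ∀ i, r i true + r i false = 1)
  (hprob : ∀ s, G.prob s = ∏ i, r i (s i))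
include h0 h1 hprob

lemma law_map_snd : G.law.map Prod.snd = Measure.pi fun i => boolLaw (r i) := by
  have := fun i => isProbabilityMeasure_boolLaw (h0 i) (h1 i)
  refine Measure.ext_of_singleton fun s => ?_
  rw [law_map_snd_singleton, Measure.pi_singleton, hprob,
    ENNReal.ofReal_prod_of_nonneg fun i _ => h0 i _]
  exact Finset.prod_congr rfl fun i _ => (boolLaw_singleton _ _).symm

lemma signalLaw_eq (i : Fin N) : G.info.signalLaw i = boolLaw (r i) := by
  have := fun i => isProbabilityMeasure_boolLaw (h0 i) (h1 i)
  have h := (measurePreserving_eval (fun i => boolLaw (r i)) i).map_eq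
  rw [← G.law_map_snd h0 h1 hprob, Measure.map_map (measurable_pi_apply i) measurable_snd] at h
  exact h

lemma isPrivatePrivate : G.info.IsPrivatePrivate := by
  have h := G.law_map_snd h0 h1 hprob
  have h' : G.info.signalLaw = fun i => boolLaw (r i) :=
    funext fun i => G.signalLaw_eq h0 h1 hprob i
  rw [InfoStructure.IsPrivatePrivate, h']
  exact h

end Product

section Bids

variable {bmax : ℝ} (bid : Fin N → Bool → ℝ) (hbid : ∀ i t, bid i t ∈ Set.Icc 0 bmax)

/-- The profile of pure strategies `bid`. -/
def profile : G.info.Profile bmax := fun i => Strategy.pure (bid i) (hbid i)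

lemma bidLaw_profile (s : Fin N → Bool) :
    G.info.bidLaw (G.profile bid hbid) s = Measure.dirac fun i => bid i (s i) := by
  have h : ∀ i, (G.profile bid hbid i).kernel (s i) = Measure.dirac (bid i (s i)) := fun i =>
    Kernel.deterministic_apply (measurable_of_finite _) _
  rw [InfoStructure.bidLaw]
  simp only [h]
  refine Measure.pi_eq fun A hA => ?_
  by_cases hx : ∀ i, bid i (s i) ∈ A i
  · rw [Measure.dirac_apply_of_mem (Set.mem_univ_pi.2 hx)]
    exact (Finset.prod_eq_one fun i _ => Measure.dirac_apply_of_mem (hx i)).symm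
  · rw [Measure.dirac_apply' _ (MeasurableSet.univ_pi hA), Set.indicator_of_notMem (by simpa using hx)]
    push Not at hx
    obtain ⟨i, hi⟩ := hx
    rw [Finset.prod_eq_zero (Finset.mem_univ i)]
    rw [Measure.dirac_apply' _ (hA i), Set.indicator_of_notMem hi]

lemma integrable_of_bids (hN : 2 ≤ N) (σ : G.info.Profile bmax) (s : Fin N → Bool) (i : Fin N) :
    Integrable (alloc i) (G.info.bidLaw σ s) ∧
      Integrable (fun b => alloc i b * secmax b) (G.info.bidLaw σ s) := by
  constructor
  · refine Integrable.of_bound (C := 1) (measurable_alloc i).aestronglyMeasurable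
      (Filter.Eventually.of_forall fun b => ?_)
    rw [Real.norm_eq_abs, abs_of_nonneg (alloc_nonneg _ _)]
    exact alloc_le_one _ _
  · refine Integrable.of_bound (C := bmax)
      ((measurable_alloc i).mul measurable_secmax).aestronglyMeasurable ?_
    filter_upwards [G.info.ae_bidLaw_mem_Icc σ s] with b hb
    have hs := InfoStructure.secmax_mem_Icc hN hb
    rw [Real.norm_eq_abs, abs_of_nonneg (mul_nonneg (alloc_nonneg _ _) hs.1)]
    exact (mul_le_of_le_one_left hs.1 (alloc_le_one _ _)).trans hs.2

/-- Bids depend on values only through signals, so payoffs see the density only through `prob` and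
`mean`. -/
lemma surplus_eq_sum (hN : 2 ≤ N) (hv : ∀ᵐ v ∂lam.toMeasure, ∀ i, v i ∈ Set.Icc (0 : ℝ) 1)
    (σ : G.info.Profile bmax) (i : Fin N) :
    G.info.surplus σ i = ∑ s, ∫ b, alloc i b * (G.mean s i - G.prob s * secmax b)
      ∂G.info.bidLaw σ s := by
  -- The product of a measure with a kernel is a kernel product over `Unit`; this form gives
  -- integrability of the payoff averaged over bids.
  have hI := Integrable.integral_compProd (κ := Kernel.const Unit G.law)
    (η := Kernel.prodMkLeft Unit (G.info.bidKernel σ)) (a := ())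
    (G.info.integrable_payoff hv σ hN i)
  rw [InfoStructure.surplus]
  refine (G.integral_law hI).trans (Finset.sum_congr rfl fun s _ => ?_)
  obtain ⟨i1, i2⟩ := G.integrable_of_bids hN σ s i
  have e : ∀ x q : ℝ, ∫ b, alloc i b * (x - q * secmax b) ∂G.info.bidLaw σ s =
      (∫ b, alloc i b ∂G.info.bidLaw σ s) * x -
        q * ∫ b, alloc i b * secmax b ∂G.info.bidLaw σ s := by
    intro x q
    rw [← integral_mul_const, ← integral_const_mul, ← integral_sub (i1.mul_const x)
      (i2.const_mul q)]
    congr 1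
    funext b
    ring
  rw [e, mean, prob, ← integral_const_mul, ← integral_mul_const,
    ← integral_sub ((G.integrable_dens_mul hv s i).const_mul _) ((G.integrable_dens s).mul_const _)]
  refine integral_congr_ae (Filter.Eventually.of_forall fun v => ?_)
  have := e (v i) 1
  simp only [one_mul] at this
  change G.dens s v * ∫ b, alloc i b * (v i - secmax b) ∂G.info.bidLaw σ s = _
  rw [this]
  ring

/-- The hypotheses make each bid optimal against the realised opposing bids at every signal profile,
as if bidders saw all signals. A deviation is then unprofitable term by term in the sum over signal
profiles. -/
lemma isBNE_profile (hN : 2 ≤ N) (hv : ∀ᵐ v ∂lam.toMeasure, ∀ i, v i ∈ Set.Icc (0 : ℝ) 1)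
    (hwin : ∀ (s : Fin N → Bool) (i j : Fin N), j ≠ i →
      (∀ k, k ≠ i → bid k (s k) ≤ bid j (s j)) → bid j (s j) < bid i (s i) →
        G.prob s * bid j (s j) ≤ G.mean s i)
    (hlose : ∀ (s : Fin N → Bool) (i j : Fin N), j ≠ i →
      (∀ k, k ≠ i → bid k (s k) ≤ bid j (s j)) → bid i (s i) < bid j (s j) →
        G.mean s i ≤ G.prob s * bid j (s j))
    (htie : ∀ (s : Fin N → Bool) (i j : Fin N), j ≠ i →
      (∀ k, k ≠ i → bid k (s k) ≤ bid j (s j)) → bid i (s i) = bid j (s j) →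
        G.mean s i = G.prob s * bid j (s j)) :
    G.info.IsBNE (G.profile bid hbid) := by
  intro i τ
  rw [G.surplus_eq_sum hN hv, G.surplus_eq_sum hN hv]
  refine Finset.sum_le_sum fun s _ => ?_
  rw [bidLaw_profile, integral_dirac]
  set c := alloc i (fun i => bid i (s i)) *
    (G.mean s i - G.prob s * secmax fun i => bid i (s i)) with hc
  set σ' := Function.update (G.profile bid hbid) i τ with hσ'
  obtain ⟨i1, i2⟩ := G.integrable_of_bids hN σ' s i
  have hint : Integrable (fun b => alloc i b * (G.mean s i - G.prob s * secmax b))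
      (G.info.bidLaw σ' s) := by
    refine ((i1.mul_const (G.mean s i)).sub (i2.const_mul (G.prob s))).congr
      (Filter.Eventually.of_forall fun b => ?_)
    simp only [Pi.sub_apply]
    ring
  have hle : ∀ᵐ b ∂G.info.bidLaw σ' s,
      alloc i b * (G.mean s i - G.prob s * secmax b) ≤ c := by
    have hother : ∀ᵐ b ∂G.info.bidLaw σ' s, ∀ j, j ≠ i → b j = bid j (s j) := by
      refine ae_all_iff.2 fun j => ?_
      by_cases hj : j = i
      · exact Filter.Eventually.of_forall fun b h => absurd hj h
      · refine (G.info.ae_bidLaw_apply σ' s j (Q := fun x => x = bid j (s j)) ?_).mono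
          fun b h _ => h
        have : (σ' j).kernel (s j) = Measure.dirac (bid j (s j)) := by
          rw [hσ', Function.update_of_ne hj]
          exact Kernel.deterministic_apply (measurable_of_finite _) _
        rw [this, ae_dirac_eq]
        rfl
    filter_upwards [hother] with b hb
    exact alloc_mul_sub_le_of_best hN hb (fun j => hwin s i j) (fun j => hlose s i j)
      (fun j => htie s i j)
  calc _ ≤ ∫ b, c ∂G.info.bidLaw σ' s := integral_mono_ae hint (integrable_const c) hle
    _ = c := by simp

lemma ae_outcome_profile {Q : (Fin N → ℝ) → (Fin N → ℝ) → Prop}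
    (hQ : MeasurableSet {p : (Fin N → ℝ) × (Fin N → ℝ) | Q p.1 p.2})
    (h : ∀ s, ∀ᵐ v ∂lam.toMeasure, 0 < G.dens s v → Q v fun i => bid i (s i)) :
    ∀ᵐ p ∂G.info.outcome (G.profile bid hbid), Q p.1.1 p.2 := by
  unfold InfoStructure.outcome
  refine Measure.ae_compProd_of_ae_ae
    (((measurable_fst.comp measurable_fst).prodMk measurable_snd) hQ) ?_
  refine G.ae_law fun s => (h s).mono fun v hv hpos => ?_
  rw [InfoStructure.bidKernel_apply, bidLaw_profile, ae_dirac_eq]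
  exact hv hpos

lemma isEfficient_profile (hN : 2 ≤ N)
    (hv : ∀ᵐ v ∂lam.toMeasure, ∀ i, v i ∈ Set.Icc (0 : ℝ) 1)
    (h : ∀ s, ∀ᵐ v ∂lam.toMeasure, 0 < G.dens s v →
      ∑ i, alloc i (fun k => bid k (s k)) * v i = ⨆ i, v i) :
    G.info.IsEfficient (G.profile bid hbid) := by
  rw [InfoStructure.isEfficient_iff _ hv _ (by omega)]
  refine G.ae_outcome_profile bid hbid (Q := fun v b => ∑ i, alloc i b * v i = ⨆ i, v i) ?_ h
  refine measurableSet_eq_fun ?_ ?_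
  · exact Finset.measurable_sum _ fun i _ => ((measurable_alloc i).comp measurable_snd).mul
      ((measurable_pi_apply i).comp measurable_fst)
  · exact Measurable.iSup fun i => (measurable_pi_apply i).comp measurable_fst

lemma maxWelfare_sub_le_bidderSurplus (hN : 2 ≤ N)
    (hv : ∀ᵐ v ∂lam.toMeasure, ∀ i, v i ∈ Set.Icc (0 : ℝ) 1)
    (heff : G.info.IsEfficient (G.profile bid hbid)) {ε : ℝ}
    (h : ∀ s : Fin N → Bool, secmax (fun k => bid k (s k)) ≤ ε) :
    maxWelfare lam - ε ≤ G.info.bidderSurplus (G.profile bid hbid) := by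
  rw [InfoStructure.bidderSurplus_eq _ hv _ hN, heff]
  have hle : ∀ᵐ p ∂G.info.outcome (G.profile bid hbid), secmax p.2 ≤ ε :=
    G.ae_outcome_profile bid hbid (Q := fun _ b => secmax b ≤ ε)
      ((measurable_secmax.comp measurable_snd) measurableSet_Iic)
      fun s => Filter.Eventually.of_forall fun v _ => h s
  have := integral_mono_ae (G.info.integrable_secmax _ hN) (integrable_const ε) hle
  simp only [integral_const, probReal_univ, one_smul] at this
  linarith

/-- If a signal made the value surely less than the bid, then so would every signal profile of
positive probability that extends it; one such profile whose conditional mean reaches the bid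
excludes this. -/
lemma noOverbidding_profile (hv : ∀ᵐ v ∂lam.toMeasure, ∀ i, v i ∈ Set.Icc (0 : ℝ) 1)
    (h : ∀ i t, G.info.signalLaw i {t} ≠ 0 →
      ∃ s : Fin N → Bool, s i = t ∧ 0 < G.prob s ∧ G.prob s * bid i t ≤ G.mean s i) :
    G.info.NoOverbidding (G.profile bid hbid) := by
  intro i
  refine ae_iff_of_countable.2 fun t ht => ?_
  have hker : (G.profile bid hbid i).kernel t = Measure.dirac (bid i t) :=
    Kernel.deterministic_apply (measurable_of_finite _) _
  rw [hker, ae_dirac_eq]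
  intro hlt
  obtain ⟨s, rfl, hq, hM⟩ := h i t ht
  -- Disintegration along bidder `i`'s signal, restricted to the atom `s i`, turns the statement on
  -- the posterior into one on the joint law.
  have hnull : G.law {p | p.2 i = s i ∧ bid i (s i) ≤ p.1 i} = 0 := by
    have hcp := compProd_map_condDistrib (mβ := inferInstance) (μ := G.law)
      (X := fun p : (Fin N → ℝ) × (Fin N → Bool) => p.2 i)
      (Y := fun p : (Fin N → ℝ) × (Fin N → Bool) => p.1 i)
      ((measurable_pi_apply i).comp measurable_fst).aemeasurable
    have hm : Measurable fun p : (Fin N → ℝ) × (Fin N → Bool) => (p.2 i, p.1 i) :=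
      ((measurable_pi_apply i).comp measurable_snd).prodMk
        ((measurable_pi_apply i).comp measurable_fst)
    have hset : MeasurableSet (({s i} : Set Bool) ×ˢ Set.Ici (bid i (s i))) :=
      (measurableSet_singleton _).prod measurableSet_Ici
    have h2 := congrArg (fun μ => μ (({s i} : Set Bool) ×ˢ Set.Ici (bid i (s i)))) hcp
    rw [Measure.map_apply hm hset,
      Measure.compProd_apply_prod (measurableSet_singleton _) measurableSet_Ici,
      lintegral_singleton] at h2
    have h3 : condDistrib (fun p : (Fin N → ℝ) × (Fin N → Bool) => p.1 i) (fun p => p.2 i) G.law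
        (s i) (Set.Ici (bid i (s i))) = 0 := by
      have h4 : ∀ᵐ x ∂G.info.posterior i (s i), ¬ x ∈ Set.Ici (bid i (s i)) :=
        Filter.Eventually.mono hlt fun x hx => not_le.2 hx
      exact measure_eq_zero_iff_ae_notMem.2 h4
    rw [h3, zero_mul] at h2
    exact h2.symm
  have hae : ∀ᵐ v ∂lam.toMeasure, 0 < G.dens s v → v i < bid i (s i) := by
    rw [law, Measure.finsetSum_apply, Finset.sum_eq_zero_iff] at hnull
    have hs := hnull s (Finset.mem_univ s)
    have hme : MeasurableEmbedding fun v : Fin N → ℝ => (v, s) :=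
      measurableEmbedding_prod_mk_right s
    rw [hme.map_apply] at hs
    have h5 : ∀ᵐ v ∂lam.toMeasure.withDensity fun v => ENNReal.ofReal (G.dens s v),
        v i < bid i (s i) := by
      rw [ae_iff]
      convert hs using 2
      ext v
      simp
    rw [ae_withDensity_iff (G.measurable_ofReal_dens s)] at h5
    filter_upwards [h5] with v hv5 hpos
    exact hv5 (by simpa using hpos)
  have hd : Integrable (fun v => G.dens s v * bid i (s i) - G.dens s v * v i) lam.toMeasure :=
    ((G.integrable_dens s).mul_const _).sub (G.integrable_dens_mul hv s i)
  have hnn : 0 ≤ᵐ[lam.toMeasure] fun v => G.dens s v * bid i (s i) - G.dens s v * v i := by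
    filter_upwards [hae] with v h6
    rcases (G.nonneg s v).eq_or_lt with h0 | h0
    · simp [← h0]
    · exact sub_nonneg.2 (mul_le_mul_of_nonneg_left (h6 h0).le h0.le)
  have hint : ∫ v, G.dens s v * bid i (s i) - G.dens s v * v i ∂lam.toMeasure = 0 := by
    refine le_antisymm ?_ (integral_nonneg_of_ae hnn)
    rw [integral_sub ((G.integrable_dens s).mul_const _) (G.integrable_dens_mul hv s i),
      integral_mul_const]
    exact sub_nonpos.2 hM
  have hz := (integral_eq_zero_iff_of_nonneg_ae hnn hd).1 hint
  have hdz : G.dens s =ᵐ[lam.toMeasure] 0 := by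
    filter_upwards [hz, hae] with v h7 h8
    by_contra hne
    have hpos : 0 < G.dens s v := (G.nonneg s v).lt_of_ne' hne
    have := mul_lt_mul_of_pos_left (h8 hpos) hpos
    simp only [Pi.zero_apply] at h7
    linarith
  rw [prob, integral_congr_ae hdz] at hq
  simp at hq

end Bids

end SignalDensity

/-! ### Independent record indicators and the uniform last record -/

/-- The law of the `k`-th record indicator in an exchangeable sequence without ties. -/
def recordProb (k : ℕ) (t : Bool) : ℝ := if t then 1 / (k + 1) else k / (k + 1)

lemma recordProb_nonneg (k : ℕ) (t : Bool) : 0 ≤ recordProb k t := by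
  unfold recordProb; split_ifs <;> positivity

lemma recordProb_pos {k : ℕ} (hk : k ≠ 0) (t : Bool) : 0 < recordProb k t := by
  have : 0 < k := Nat.pos_of_ne_zero hk
  unfold recordProb; split_ifs <;> positivity

lemma recordProb_add (k : ℕ) : recordProb k true + recordProb k false = 1 := by
  have : (k : ℝ) + 1 ≠ 0 := by positivity
  simp only [recordProb, if_true, Bool.false_eq_true, if_false]
  field_simp
  ring

/-- The factors beyond `i` telescope: `1 / (i + 1)` times `k / (k + 1)` for `i < k < m` is `1 / m`,
whatever `i` is. -/
lemma prod_range_last (i m : ℕ) :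
    ∏ k ∈ Finset.range m,
      (if k < i then (1 : ℝ) else if k = i then 1 / (k + 1) else k / (k + 1)) =
      if m ≤ i then (1 : ℝ) else 1 / m := by
  induction m with
  | zero => simp
  | succ m ih =>
    rw [Finset.prod_range_succ, ih]
    rcases lt_trichotomy m i with h | h | h
    · simp [h, h.le, Nat.succ_le_of_lt h]
    · subst h; simp
    · have h1 : ¬ m ≤ i := by omega
      have h2 : ¬ m < i := by omega
      have h3 : ¬ m = i := by omega
      have h4 : ¬ m + 1 ≤ i := by omega
      have h5 : (m : ℝ) ≠ 0 := by
        have : 0 < m := by omega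
        positivity
      simp only [h1, h2, h3, h4, if_false]
      push_cast
      field_simp

section Signals

variable {n : ℕ}

/-- The probability of the record indicators of the bidders other than the first. -/
def recordWeight (s : Fin (n + 1) → Bool) : ℝ :=
  ∏ k : Fin n, recordProb ((k : ℕ) + 1) (s k.succ)

lemma recordWeight_pos (s : Fin (n + 1) → Bool) : 0 < recordWeight s :=
  Finset.prod_pos fun k _ => recordProb_pos (Nat.succ_ne_zero k) _

/-- The last record, the first bidder being a record whatever her signal. -/
def lastRecord (s : Fin (n + 1) → Bool) : Fin (n + 1) :=
  (Finset.univ.filter fun k => k = 0 ∨ s k = true).max' ⟨0, by simp⟩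

lemma lastRecord_spec (s : Fin (n + 1) → Bool) : lastRecord s = 0 ∨ s (lastRecord s) = true := by
  have := Finset.max'_mem (Finset.univ.filter fun k => k = 0 ∨ s k = true) ⟨0, by simp⟩
  exact (Finset.mem_filter.1 this).2

lemma le_lastRecord {s : Fin (n + 1) → Bool} {k : Fin (n + 1)} (h : s k = true) :
    k ≤ lastRecord s :=
  Finset.le_max' _ _ (by simp [h])

lemma eq_false_of_lastRecord_lt {s : Fin (n + 1) → Bool} {k : Fin (n + 1)}
    (h : lastRecord s < k) : s k = false := by
  by_contra hk
  exact absurd (le_lastRecord (by simpa using hk)) (not_le.2 h)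

lemma lastRecord_eq_iff {s : Fin (n + 1) → Bool} {i : Fin (n + 1)} :
    lastRecord s = i ↔ (i = 0 ∨ s i = true) ∧ ∀ k, i < k → s k = false := by
  constructor
  · rintro rfl
    exact ⟨lastRecord_spec s, fun k => eq_false_of_lastRecord_lt⟩
  · rintro ⟨h1, h2⟩
    apply le_antisymm
    · by_contra h
      push Not at h
      have h3 := h2 _ h
      rcases lastRecord_spec s with h4 | h4
      · rw [h4] at h; exact absurd h (Fin.not_lt_zero i)
      · rw [h3] at h4; exact Bool.false_ne_true h4
    · rcases h1 with rfl | h1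
      · exact Fin.zero_le _
      · exact le_lastRecord h1

lemma sum_prod_signals (f : Fin (n + 1) → Bool → ℝ) :
    ∑ s : Fin (n + 1) → Bool, ∏ k, f k (s k) = ∏ k, (f k true + f k false) := by
  have := (Finset.prod_univ_sum (fun _ : Fin (n + 1) => (Finset.univ : Finset Bool)) f).symm
  rw [Fintype.piFinset_univ] at this
  simpa using this

lemma sum_recordWeight_of_true :
    ∑ s : Fin (n + 1) → Bool, (if s 0 = true then recordWeight s else 0) = 1 := by
  have h := sum_prod_signals (n := n)
    (Fin.cons (fun t => if t = true then 1 else 0) fun k => recordProb ((k : ℕ) + 1))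
  simp only [Fin.prod_univ_succ, Fin.cons_zero, Fin.cons_succ, recordProb_add] at h
  simp only [ite_mul, one_mul, zero_mul] at h
  simpa [recordWeight] using h

lemma sum_recordWeight_of_lastRecord (i : Fin (n + 1)) :
    ∑ s : Fin (n + 1) → Bool,
      (if s 0 = false ∧ lastRecord s = i then recordWeight s else 0) = 1 / (n + 1) := by
  -- The event that bidder `0` has the low signal and `i` is the last record is a box: nothing is
  -- required strictly between `0` and `i`, a record at `i` unless `i = 0`, and none beyond. Its
  -- weight is therefore a product over bidders.
  have h := sum_prod_signals (n := n) fun k t =>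
    if k = 0 then (if t = true then 0 else 1) else if k < i then recordProb k t
      else if k = i then (if t = true then recordProb k t else 0)
      else (if t = true then 0 else recordProb k t)
  have hR : ∀ k : Fin (n + 1), ((if k = 0 then (if true = true then (0 : ℝ) else 1)
        else if k < i then recordProb k true
        else if k = i then (if true = true then recordProb k true else 0)
        else (if true = true then 0 else recordProb k true)) +
      (if k = 0 then (if false = true then 0 else 1) else if k < i then recordProb k false
        else if k = i then (if false = true then recordProb k false else 0)
        else (if false = true then 0 else recordProb k false))) =
      (fun k : ℕ => if k < (i : ℕ) then (1 : ℝ) else if k = i then 1 / (k + 1)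
        else k / (k + 1)) k := by
    intro k
    by_cases hk : k = 0
    · subst hk
      rcases (Fin.zero_le i).eq_or_lt with hi | hi
      · subst hi; simp
      · have : (0 : ℕ) < i := hi
        simp [this]
    · rcases lt_trichotomy k i with hi | hi | hi
      · have : (k : ℕ) < i := hi
        simp [hk, hi, this, recordProb_add]
      · subst hi; simp [hk, recordProb]
      · have h1 : ¬ k < i := not_lt.2 hi.le
        have h2 : ¬ k = i := hi.ne'
        have h3 : ¬ (k : ℕ) < i := h1
        have h4 : ¬ (k : ℕ) = i := fun h => h2 (Fin.ext h)
        simp [hk, h1, h2, h3, h4, recordProb]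
  replace h := h.trans (Finset.prod_congr rfl fun k _ => hR k)
  rw [Fin.prod_univ_eq_prod_range (fun k : ℕ => if k < (i : ℕ) then (1 : ℝ)
    else if k = i then 1 / (k + 1) else k / (k + 1)) (n + 1), prod_range_last] at h
  have hni : ¬ n + 1 ≤ (i : ℕ) := not_le.2 i.2
  rw [if_neg hni] at h
  push_cast at h
  rw [← h]
  refine Finset.sum_congr rfl fun s _ => ?_
  by_cases hs : s 0 = false ∧ lastRecord s = i
  · rw [if_pos hs, recordWeight, Fin.prod_univ_succ, if_pos rfl, hs.1]
    simp only [Bool.false_eq_true, if_false, one_mul]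
    refine Finset.prod_congr rfl fun k _ => ?_
    obtain ⟨h1, h2⟩ := lastRecord_eq_iff.1 hs.2
    rw [if_neg (Fin.succ_ne_zero k)]
    rcases lt_trichotomy k.succ i with hi | hi | hi
    · simp [hi]
    · subst hi
      rcases h1 with h1 | h1
      · exact absurd h1 (Fin.succ_ne_zero k)
      · simp [h1]
    · simp [not_lt.2 hi.le, hi.ne', h2 _ hi]
  · rw [if_neg hs]
    symm
    by_cases h0 : s 0 = true
    · exact Finset.prod_eq_zero (Finset.mem_univ 0) (by simp [h0])
    · have h0' : s 0 = false := by simpa using h0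
      have hl : ¬ ((i = 0 ∨ s i = true) ∧ ∀ k, i < k → s k = false) := fun hl =>
        hs ⟨h0', lastRecord_eq_iff.2 hl⟩
      by_cases h1 : i = 0 ∨ s i = true
      · have h2 : ∃ k, i < k ∧ s k = true := by
          by_contra! hcon
          exact hl ⟨h1, fun k hk => by simpa using hcon k hk⟩
        obtain ⟨k, hk, hsk⟩ := h2
        refine Finset.prod_eq_zero (Finset.mem_univ k) ?_
        have : k ≠ 0 := fun h => absurd hk (by rw [h]; exact Fin.not_lt_zero i)
        simp [this, not_lt.2 hk.le, hk.ne', hsk]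
      · push Not at h1
        refine Finset.prod_eq_zero (Finset.mem_univ i) ?_
        simp [h1.1, h1.2]

/-! ### Designated winners and symmetry of the prior -/

/-- The indicator that all values are positive. -/
def allPos (v : Fin (n + 1) → ℝ) : ℝ :=
  open Classical in if ∀ j, 0 < v j then 1 else 0

/-- The relative weight of bidder `i` as the designated winner at the value profile `v`. -/
def winnerWeight (i : Fin (n + 1)) (v : Fin (n + 1) → ℝ) : ℝ :=
  open Classical in
  if ∀ j, 0 < v j then 0 else if v = 0 then 1 else if 0 < v i then n + 1 else 0

lemma measurableSet_forall_pos : MeasurableSet {v : Fin (n + 1) → ℝ | ∀ j, 0 < v j} := by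
  rw [Set.ofPred_forall]
  exact MeasurableSet.iInter fun j => measurableSet_lt measurable_const (measurable_pi_apply j)

lemma measurable_allPos : Measurable (allPos : (Fin (n + 1) → ℝ) → ℝ) :=
  Measurable.ite measurableSet_forall_pos measurable_const measurable_const

lemma measurable_winnerWeight (i : Fin (n + 1)) : Measurable (winnerWeight i) :=
  Measurable.ite measurableSet_forall_pos measurable_const
    (Measurable.ite (measurableSet_singleton 0) measurable_const
      (Measurable.ite (measurableSet_lt measurable_const (measurable_pi_apply i))
        measurable_const measurable_const))

lemma allPos_nonneg (v : Fin (n + 1) → ℝ) : 0 ≤ allPos v := by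
  unfold allPos; split_ifs <;> norm_num

lemma allPos_le_one (v : Fin (n + 1) → ℝ) : allPos v ≤ 1 := by
  unfold allPos; split_ifs <;> norm_num

lemma winnerWeight_nonneg (i : Fin (n + 1)) (v : Fin (n + 1) → ℝ) : 0 ≤ winnerWeight i v := by
  unfold winnerWeight; split_ifs <;> positivity

lemma winnerWeight_le (i : Fin (n + 1)) (v : Fin (n + 1) → ℝ) : winnerWeight i v ≤ n + 1 := by
  unfold winnerWeight
  split_ifs <;> linarith [(Nat.cast_nonneg n : (0 : ℝ) ≤ n)]

/-- Equal values, or only one positive value. -/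
def EqualOrSingle (v : Fin (n + 1) → ℝ) : Prop :=
  (∀ i j, v i = v j) ∨ ∃ i, 0 < v i ∧ ∀ j, j ≠ i → v j = 0

/-- These are the branches of `winnerWeight`. With at least two bidders, a single positive value
excludes that all are positive. -/
lemma EqualOrSingle.cases (hn : 0 < n) {v : Fin (n + 1) → ℝ} (h : EqualOrSingle v)
    (hv : ∀ i, 0 ≤ v i) :
    ((∀ j, 0 < v j) ∧ ∀ i j, v i = v j) ∨ v = 0 ∨
      ((¬ ∀ j, 0 < v j) ∧ v ≠ 0 ∧ ∃ i, 0 < v i ∧ ∀ j, j ≠ i → v j = 0) := by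
  rcases h with h | ⟨i, hi, hj⟩
  · rcases (hv 0).eq_or_lt with h0 | h0
    · exact Or.inr (Or.inl (funext fun j => (h j 0).trans h0.symm))
    · exact Or.inl ⟨fun j => (h j 0).symm ▸ h0, h⟩
  · refine Or.inr (Or.inr ⟨fun hall => ?_, fun h0 => ?_, i, hi, hj⟩)
    · have : Nontrivial (Fin (n + 1)) := Fin.nontrivial_iff_two_le.2 (by omega)
      obtain ⟨j, hji⟩ := exists_ne i
      exact (hall j).ne' (hj j hji)
    · rw [h0] at hi; exact lt_irrefl _ hi

/-- The total `n + 1` offsets the probability `1 / (n + 1)` of each last record; at `v = 0` it is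
spread evenly, as nobody is distinguished. -/
lemma sum_winnerWeight (hn : 0 < n) {v : Fin (n + 1) → ℝ} (h : EqualOrSingle v)
    (hv : ∀ i, 0 ≤ v i) : ∑ i, winnerWeight i v = (n + 1) * (1 - allPos v) := by
  rcases h.cases hn hv with ⟨h1, -⟩ | rfl | ⟨h1, h2, i, hi, hj⟩
  · simp [winnerWeight, allPos, h1]
  · simp [winnerWeight, allPos]
  · rw [Finset.sum_eq_single i]
    · simp [winnerWeight, allPos, h1, h2, hi]
    · intro j _ hji; simp [winnerWeight, h1, h2, hj j hji]
    · simp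

lemma winnerWeight_mul_eq_zero (hn : 0 < n) {v : Fin (n + 1) → ℝ} (h : EqualOrSingle v)
    (hv : ∀ i, 0 ≤ v i) {i j : Fin (n + 1)} (hij : j ≠ i) : winnerWeight i v * v j = 0 := by
  rcases h.cases hn hv with ⟨h1, -⟩ | rfl | ⟨h1, h2, k, hk, hk'⟩
  · simp [winnerWeight, h1]
  · simp
  · by_cases hjk : j = k
    · subst hjk; simp [winnerWeight, h1, h2, hk' i hij.symm]
    · simp [hk' j hjk]

lemma winnerWeight_comp_perm (τ : Equiv.Perm (Fin (n + 1))) (i : Fin (n + 1))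
    (v : Fin (n + 1) → ℝ) : winnerWeight i (v ∘ τ) = winnerWeight (τ i) v := by
  have h1 : (∀ j, 0 < (v ∘ τ) j) ↔ ∀ j, 0 < v j :=
    τ.forall_congr_left.trans (by simp)
  have h2 : v ∘ τ = 0 ↔ v = 0 := by
    simp only [funext_iff]
    exact τ.forall_congr_left.trans (by simp)
  simp only [winnerWeight, h1, h2]
  rfl

end Signals

lemma map_comp_perm {N : ℕ} {lam : PMF (Fin N → ℝ)}
    (hsymm : ∀ (τ : Equiv.Perm (Fin N)) (v : Fin N → ℝ), lam (v ∘ τ) = lam v)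
    (τ : Equiv.Perm (Fin N)) : lam.toMeasure.map (fun v => v ∘ τ) = lam.toMeasure := by
  have hm : Measurable fun v : Fin N → ℝ => v ∘ τ :=
    measurable_pi_lambda _ fun i => measurable_pi_apply (τ i)
  ext A hA
  rw [Measure.map_apply hm hA, PMF.toMeasure_apply _ (hm hA), PMF.toMeasure_apply _ hA]
  rw [← (Equiv.arrowCongr τ.symm (Equiv.refl ℝ)).tsum_eq (A.indicator lam)]
  refine tsum_congr fun v => ?_
  have he : (Equiv.arrowCongr τ.symm (Equiv.refl ℝ)) v = v ∘ τ := rfl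
  rw [he]
  by_cases h : v ∘ τ ∈ A
  · rw [Set.indicator_of_mem h, Set.indicator_of_mem (by exact h), hsymm]
  · rw [Set.indicator_of_notMem h, Set.indicator_of_notMem (by exact h)]

lemma integral_comp_perm {N : ℕ} {lam : PMF (Fin N → ℝ)}
    (hsymm : ∀ (τ : Equiv.Perm (Fin N)) (v : Fin N → ℝ), lam (v ∘ τ) = lam v)
    (τ : Equiv.Perm (Fin N)) {F : (Fin N → ℝ) → ℝ} (hF : Measurable F) :
    ∫ v, F (v ∘ τ) ∂lam.toMeasure = ∫ v, F v ∂lam.toMeasure := by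
  have hm : Measurable fun v : Fin N → ℝ => v ∘ τ :=
    measurable_pi_lambda _ fun i => measurable_pi_apply (τ i)
  conv_rhs => rw [← map_comp_perm hsymm τ]
  rw [integral_map hm.aemeasurable hF.aestronglyMeasurable]

/-! ### Sufficiency: the record signals and their conditional means -/

section Construction

variable {n : ℕ} {lam : PMF (Fin (n + 1) → ℝ)}

/-- The first bidder's signal tells her whether all values are positive; otherwise the last record
among the signals is the bidder with the positive value. -/
def recordDens (s : Fin (n + 1) → Bool) (v : Fin (n + 1) → ℝ) : ℝ :=
  recordWeight s * if s 0 = true then allPos v else winnerWeight (lastRecord s) v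

lemma sum_recordDens (hn : 0 < n) {v : Fin (n + 1) → ℝ} (h : EqualOrSingle v)
    (hv : ∀ i, 0 ≤ v i) : ∑ s, recordDens s v = 1 := by
  have e : ∀ s : Fin (n + 1) → Bool, recordDens s v =
      (if s 0 = true then recordWeight s else 0) * allPos v +
        ∑ i, (if s 0 = false ∧ lastRecord s = i then recordWeight s else 0) *
          winnerWeight i v := by
    intro s
    by_cases h0 : s 0 = true
    · simp [recordDens, h0]
    · have h0' : s 0 = false := by simpa using h0
      simp [recordDens, h0']
  simp only [e]
  rw [Finset.sum_add_distrib, ← Finset.sum_mul, sum_recordWeight_of_true, Finset.sum_comm]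
  simp only [← Finset.sum_mul, sum_recordWeight_of_lastRecord]
  rw [← Finset.mul_sum, sum_winnerWeight hn h hv]
  have : (n : ℝ) + 1 ≠ 0 := by positivity
  field_simp
  ring

/-- The record signal density. -/
def recordDensity (hn : 0 < n) (hb : ∀ᵐ v ∂lam.toMeasure, EqualOrSingle v)
    (hv : ∀ᵐ v ∂lam.toMeasure, ∀ i, v i ∈ Set.Icc (0 : ℝ) 1) : SignalDensity lam where
  dens := recordDens
  measurable_dens s := by
    unfold recordDens
    refine measurable_const.mul ?_
    split_ifs
    · exact measurable_allPos
    · exact measurable_winnerWeight _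
  nonneg s v := by
    unfold recordDens
    refine mul_nonneg (recordWeight_pos s).le ?_
    split_ifs
    · exact allPos_nonneg v
    · exact winnerWeight_nonneg _ v
  sum_eq := by
    filter_upwards [hb, hv] with v h1 h2 using sum_recordDens hn h1 fun i => (h2 i).1

/-- The probability that all values are positive. -/
def posProb (lam : PMF (Fin (n + 1) → ℝ)) : ℝ := ∫ v, allPos v ∂lam.toMeasure

/-- The expected value of a bidder on the event that all values are positive. -/
def posMean (lam : PMF (Fin (n + 1) → ℝ)) : ℝ := ∫ v, allPos v * v 0 ∂lam.toMeasure

/-- The expected value of the designated winner on the event that not all values are positive. -/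
def winnerMean (lam : PMF (Fin (n + 1) → ℝ)) : ℝ := ∫ v, winnerWeight 0 v * v 0 ∂lam.toMeasure

lemma integrable_allPos : Integrable allPos lam.toMeasure :=
  Integrable.of_bound (C := 1) measurable_allPos.aestronglyMeasurable
    (Filter.Eventually.of_forall fun v => by
      rw [Real.norm_eq_abs, abs_of_nonneg (allPos_nonneg v)]; exact allPos_le_one v)

lemma integrable_winnerWeight (i : Fin (n + 1)) : Integrable (winnerWeight i) lam.toMeasure :=
  Integrable.of_bound (C := n + 1) (measurable_winnerWeight i).aestronglyMeasurable
    (Filter.Eventually.of_forall fun v => by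
      rw [Real.norm_eq_abs, abs_of_nonneg (winnerWeight_nonneg i v)]; exact winnerWeight_le i v)

section Means

variable (hn : 0 < n) (hb : ∀ᵐ v ∂lam.toMeasure, EqualOrSingle v)
  (hv : ∀ᵐ v ∂lam.toMeasure, ∀ i, v i ∈ Set.Icc (0 : ℝ) 1)
  (hsymm : ∀ (τ : Equiv.Perm (Fin (n + 1))) (v : Fin (n + 1) → ℝ), lam (v ∘ τ) = lam v)

include hv in
lemma integrable_mul_value {f : (Fin (n + 1) → ℝ) → ℝ} (hf : Integrable f lam.toMeasure)
    (i : Fin (n + 1)) : Integrable (fun v => f v * v i) lam.toMeasure := by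
  refine hf.mono (hf.aestronglyMeasurable.mul (measurable_pi_apply i).aestronglyMeasurable) ?_
  filter_upwards [hv] with v hv'
  rw [norm_mul]
  refine mul_le_of_le_one_right (norm_nonneg _) ?_
  rw [Real.norm_eq_abs, abs_of_nonneg (hv' i).1]
  exact (hv' i).2

include hsymm in
lemma integral_winnerWeight_eq (i : Fin (n + 1)) :
    ∫ v, winnerWeight i v ∂lam.toMeasure = ∫ v, winnerWeight 0 v ∂lam.toMeasure := by
  rw [← integral_comp_perm hsymm (Equiv.swap 0 i) (measurable_winnerWeight 0)]
  simp only [winnerWeight_comp_perm, Equiv.swap_apply_left]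

include hn hb hv hsymm in
-- By symmetry the integral is the same for all bidders, and the sum is known. Independence of
-- bidder `0`'s signal from the record indicators rests on this.
lemma integral_winnerWeight (i : Fin (n + 1)) :
    ∫ v, winnerWeight i v ∂lam.toMeasure = 1 - posProb lam := by
  have h1 : ∫ v, ∑ i, winnerWeight i v ∂lam.toMeasure = (n + 1) * (1 - posProb lam) := by
    have h2 : ∀ᵐ v ∂lam.toMeasure, ∑ i, winnerWeight i v = (n + 1) * (1 - allPos v) := by
      filter_upwards [hb, hv] with v h1 h2 using sum_winnerWeight hn h1 fun i => (h2 i).1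
    rw [integral_congr_ae h2, integral_const_mul,
      integral_sub (integrable_const _) integrable_allPos, posProb]
    simp
  rw [integral_finsetSum _ fun i _ => integrable_winnerWeight i] at h1
  simp only [integral_winnerWeight_eq hsymm] at h1
  rw [Finset.sum_const, Finset.card_fin, nsmul_eq_mul] at h1
  push_cast at h1
  rw [integral_winnerWeight_eq hsymm]
  exact mul_left_cancel₀ (by positivity : (n : ℝ) + 1 ≠ 0) h1

include hsymm in
lemma integral_winnerWeight_mul (i : Fin (n + 1)) :
    ∫ v, winnerWeight i v * v i ∂lam.toMeasure = winnerMean lam := by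
  rw [winnerMean, ← integral_comp_perm hsymm (Equiv.swap 0 i)
    (F := fun v => winnerWeight 0 v * v 0)
    ((measurable_winnerWeight 0).mul (measurable_pi_apply 0))]
  simp only [winnerWeight_comp_perm, Equiv.swap_apply_left, Function.comp_apply]

include hsymm in
lemma prob_recordDensity (s : Fin (n + 1) → Bool) :
    (recordDensity hn hb hv).prob s =
      recordWeight s * if s 0 = true then posProb lam else 1 - posProb lam := by
  change ∫ v, recordWeight s * (if s 0 = true then allPos v else winnerWeight (lastRecord s) v)
    ∂lam.toMeasure = _
  rw [integral_const_mul]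
  congr 1
  split_ifs
  · rfl
  · exact integral_winnerWeight hn hb hv hsymm _

include hsymm in
lemma mean_recordDensity (s : Fin (n + 1) → Bool) (i : Fin (n + 1)) :
    (recordDensity hn hb hv).mean s i =
      recordWeight s * if s 0 = true then posMean lam
        else if i = lastRecord s then winnerMean lam else 0 := by
  change ∫ v, recordWeight s * (if s 0 = true then allPos v else winnerWeight (lastRecord s) v)
    * v i ∂lam.toMeasure = _
  simp only [mul_assoc]
  rw [integral_const_mul]
  congr 1
  split_ifs with h0 hi
  · refine integral_congr_ae ?_
    filter_upwards [hb, hv] with v h1 h2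
    rcases h1.cases hn fun i => (h2 i).1 with ⟨-, h3⟩ | rfl | ⟨h3, -⟩
    · rw [h3 i 0]
    · simp
    · simp [allPos, h3]
  · rw [hi]; exact integral_winnerWeight_mul hsymm _
  · rw [← integral_zero (Fin (n + 1) → ℝ) ℝ (μ := lam.toMeasure)]
    refine integral_congr_ae ?_
    filter_upwards [hb, hv] with v h1 h2
    exact winnerWeight_mul_eq_zero hn h1 (fun i => (h2 i).1) hi

lemma posProb_nonneg : 0 ≤ posProb lam := integral_nonneg allPos_nonneg

lemma posProb_le_one : posProb lam ≤ 1 := by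
  have := integral_mono (integrable_allPos (lam := lam)) (integrable_const 1) allPos_le_one
  simpa [posProb] using this

include hv in
lemma posMean_nonneg : 0 ≤ posMean lam := by
  refine integral_nonneg_of_ae ?_
  filter_upwards [hv] with v h using mul_nonneg (allPos_nonneg v) (h 0).1

include hv in
lemma winnerMean_nonneg : 0 ≤ winnerMean lam := by
  refine integral_nonneg_of_ae ?_
  filter_upwards [hv] with v h using mul_nonneg (winnerWeight_nonneg 0 v) (h 0).1

include hv in
lemma posMean_le {c : ℝ} (hc : ∀ᵐ v ∂lam.toMeasure, ∀ i, v i ≤ c) :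
    posMean lam ≤ posProb lam * c := by
  rw [posMean, posProb, ← integral_mul_const]
  refine integral_mono_ae (integrable_mul_value hv integrable_allPos 0)
    (integrable_allPos.mul_const c) ?_
  filter_upwards [hc] with v h using mul_le_mul_of_nonneg_left (h 0) (allPos_nonneg v)

include hv in
lemma posMean_pos (hp : 0 < posProb lam) : 0 < posMean lam := by
  refine (posMean_nonneg hv).lt_of_ne' fun h0 => hp.ne' ?_
  have hz := (integral_eq_zero_iff_of_nonneg_ae
    (by filter_upwards [hv] with v h using mul_nonneg (allPos_nonneg v) (h 0).1)
    (integrable_mul_value hv integrable_allPos 0)).1 h0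
  rw [posProb, ← integral_zero (Fin (n + 1) → ℝ) ℝ (μ := lam.toMeasure)]
  refine integral_congr_ae ?_
  filter_upwards [hz] with v h
  by_cases hall : ∀ j, 0 < v j
  · exact (mul_eq_zero.1 h).resolve_right (hall 0).ne'
  · simp [allPos, hall]

include hv hsymm in
-- If `winnerMean` vanishes, so does almost surely each nonnegative integrand. Efficiency needs
-- this: wherever the identity of the winner matters, the ladder is strict.
lemma winnerMean_pos_of_pos : ∀ᵐ v ∂lam.toMeasure, ∀ i,
    0 < winnerWeight i v → 0 < v i → 0 < winnerMean lam := by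
  by_cases h0 : 0 < winnerMean lam
  · exact Filter.Eventually.of_forall fun _ _ _ _ => h0
  refine ae_all_iff.2 fun i => ?_
  have hX : ∫ v, winnerWeight i v * v i ∂lam.toMeasure = 0 := by
    rw [integral_winnerWeight_mul hsymm]
    exact le_antisymm (not_lt.1 h0) (winnerMean_nonneg hv)
  have hz := (integral_eq_zero_iff_of_nonneg_ae
    (by filter_upwards [hv] with v h using mul_nonneg (winnerWeight_nonneg i v) (h i).1)
    (integrable_mul_value hv (integrable_winnerWeight i) i)).1 hX
  filter_upwards [hz] with v h h1 h2
  exact absurd h (mul_pos h1 h2).ne'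

end Means

/-! ### The ladder of bids and the equilibrium -/

/-- The first bidder bids `B` if all values are positive; the bids of the records increase up to
`L`, and all other bids vanish. -/
def recordBid (B L : ℝ) (k : Fin (n + 1)) (t : Bool) : ℝ :=
  if k = 0 then (if t = true then B else L / (n + 1))
    else if t = true then (k + 1) * L / (n + 1) else 0

lemma recordBid_zero_true (B L : ℝ) : recordBid B L (0 : Fin (n + 1)) true = B := by
  simp [recordBid]

lemma ladder_le {L : ℝ} (hL : 0 ≤ L) (k : Fin (n + 1)) : (k + 1) * L / (n + 1) ≤ L := by
  rw [div_le_iff₀ (by positivity)]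
  have : (k : ℝ) ≤ n := by exact_mod_cast Nat.lt_succ_iff.1 k.2
  nlinarith

lemma recordBid_le_ladder {B L : ℝ} (hL : 0 ≤ L) {k : Fin (n + 1)} {t : Bool}
    (h : k ≠ 0 ∨ t = false) : recordBid B L k t ≤ (k + 1) * L / (n + 1) := by
  unfold recordBid
  by_cases hk : k = 0
  · subst hk
    have ht : t = false := by simpa using h
    simp [ht]
  · simp only [hk, if_false]
    split_ifs
    · exact le_rfl
    · positivity

lemma recordBid_le {B L : ℝ} (hL : 0 ≤ L) {k : Fin (n + 1)} {t : Bool}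
    (h : k ≠ 0 ∨ t = false) : recordBid B L k t ≤ L :=
  (recordBid_le_ladder hL h).trans (ladder_le hL k)

lemma recordBid_nonneg {B L : ℝ} (hB : 0 ≤ B) (hL : 0 ≤ L) (k : Fin (n + 1)) (t : Bool) :
    0 ≤ recordBid B L k t := by
  unfold recordBid; split_ifs <;> positivity

lemma recordBid_lastRecord {B L : ℝ} {s : Fin (n + 1) → Bool} (h0 : s 0 = false) :
    recordBid B L (lastRecord s) (s (lastRecord s)) = (lastRecord s + 1) * L / (n + 1) := by
  rcases lastRecord_spec s with h | h
  · simp [h, recordBid, h0]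
  · have : lastRecord s ≠ 0 := fun h' => by rw [h', h0] at h; exact Bool.false_ne_true h
    simp [recordBid, this, h]

lemma recordBid_lt_lastRecord {B L : ℝ} (hL : 0 < L) {s : Fin (n + 1) → Bool}
    (h0 : s 0 = false) {k : Fin (n + 1)} (hk : k ≠ lastRecord s) :
    recordBid B L k (s k) < recordBid B L (lastRecord s) (s (lastRecord s)) := by
  rw [recordBid_lastRecord h0]
  rcases lt_or_gt_of_ne hk with h | h
  · refine (recordBid_le_ladder hL.le ?_).trans_lt ?_
    · by_cases hk0 : k = 0
      · right; rw [hk0, h0]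
      · exact Or.inl hk0
    · have : (k : ℝ) < (lastRecord s : ℕ) := by exact_mod_cast h
      gcongr
  · have hk0 : k ≠ 0 := fun h' => by rw [h'] at h; exact absurd h (Fin.not_lt_zero _)
    have : recordBid B L k (s k) = 0 := by
      simp [recordBid, hk0, eq_false_of_lastRecord_lt h]
    rw [this]
    positivity

lemma recordBid_le_lastRecord {B L : ℝ} (hL : 0 ≤ L) {s : Fin (n + 1) → Bool}
    (h0 : s 0 = false) (k : Fin (n + 1)) :
    recordBid B L k (s k) ≤ recordBid B L (lastRecord s) (s (lastRecord s)) := by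
  rcases hL.eq_or_lt with h | h
  · subst h
    have hz : ∀ k : Fin (n + 1), recordBid B 0 k (s k) = 0 := fun k => by
      by_cases hk : k = 0
      · subst hk; simp [recordBid, h0]
      · simp [recordBid, hk]
    rw [hz, hz]
  · by_cases hk : k = lastRecord s
    · rw [← hk]
    · exact (recordBid_lt_lastRecord h h0 hk).le

/-- The law of the signals: the first bidder learns whether all values are positive, the others
see independent record indicators. -/
def signalProb (p : ℝ) (k : Fin (n + 1)) (t : Bool) : ℝ :=
  if k = 0 then (if t = true then p else 1 - p) else recordProb k t

lemma prod_signalProb (p : ℝ) (s : Fin (n + 1) → Bool) :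
    ∏ k, signalProb p k (s k) = recordWeight s * if s 0 = true then p else 1 - p := by
  rw [Fin.prod_univ_succ, mul_comm]
  simp [signalProb, recordWeight]

/-- If every value profile in the support has equal values or only one positive value, then there
are efficient equilibria with arbitrarily little revenue. -/
lemma exists_of_equalOrSingle (hn : 0 < n) {vmax : ℝ}
    (hb : ∀ᵐ v ∂lam.toMeasure, EqualOrSingle v)
    (hv : ∀ᵐ v ∂lam.toMeasure, ∀ i, v i ∈ Set.Icc (0 : ℝ) 1)
    (hvm : ∀ᵐ v ∂lam.toMeasure, ∀ i, v i ≤ vmax) (hvm0 : 0 ≤ vmax)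
    (hsymm : ∀ (τ : Equiv.Perm (Fin (n + 1))) (v : Fin (n + 1) → ℝ), lam (v ∘ τ) = lam v)
    {ε : ℝ} (hε : 0 < ε) :
    ∃ I : InfoStructure lam, I.IsPrivatePrivate ∧ ∃ σ : I.Profile vmax,
      I.NoOverbidding σ ∧ I.IsBNE σ ∧ I.IsEfficient σ ∧
        maxWelfare lam - ε ≤ I.bidderSurplus σ := by
  have hN : 2 ≤ n + 1 := by omega
  set G := recordDensity hn hb hv with hG
  set p := posProb lam with hp
  set Y := posMean lam with hY
  set X := winnerMean lam with hX
  have hp0 : 0 ≤ p := posProb_nonneg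
  have hp1 : p ≤ 1 := posProb_le_one
  have hY0 : 0 ≤ Y := posMean_nonneg hv
  have hX0 : 0 ≤ X := winnerMean_nonneg hv
  have hYle : Y ≤ p * vmax := posMean_le hv hvm
  -- The expected common value given that all values are positive; if `p = 0`, the quotient is `0`,
  -- and `p * B = Y` persists because then `Y = 0`.
  set B := Y / p with hB
  have hpB : p * B = Y := by
    rcases hp0.eq_or_lt with h | h
    · rw [← h, zero_mul] at hYle ⊢
      exact hY0.antisymm hYle
    · rw [hB, mul_div_cancel₀ _ h.ne']
  have hB0 : 0 ≤ B := by positivity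
  have hBle : B ≤ vmax := div_le_of_le_mul₀ hp0 hvm0 (by linarith)
  -- `L ≤ ε` bounds revenue, `L ≤ X` makes winning worth the price for the last record, `L ≤ vmax`
  -- keeps bids feasible, and `L ≤ B` keeps bidder `0` on top after good news. `L` may vanish only
  -- if `X` does; `L ≤ B` is not asked for `p = 0`, where `B = 0`.
  obtain ⟨L, hL0, hLε, hLX, hLv, hLB, hLpos⟩ : ∃ L : ℝ, 0 ≤ L ∧ L ≤ ε ∧ L ≤ X ∧ L ≤ vmax ∧
      (0 < p → L ≤ B) ∧ (0 < X → 0 < L) := by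
    rcases hX0.eq_or_lt with h | h
    · exact ⟨0, le_rfl, hε.le, h.le, hvm0, fun _ => hB0, fun h' => absurd h' (h ▸ lt_irrefl _)⟩
    have hvpos : 0 < vmax := by
      refine hvm0.lt_of_ne' fun h0 => h.ne' ?_
      rw [hX, winnerMean, ← integral_zero (Fin (n + 1) → ℝ) ℝ (μ := lam.toMeasure)]
      refine integral_congr_ae ?_
      filter_upwards [hv, hvm] with v h1 h2
      have : v 0 = 0 := le_antisymm (h0 ▸ h2 0) (h1 0).1
      rw [this, mul_zero]
    by_cases hpp : 0 < p
    · have hBpos : 0 < B := div_pos (posMean_pos hv hpp) hpp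
      refine ⟨min (min ε X) (min vmax B), ?_, ?_, ?_, ?_, ?_, ?_⟩
      · positivity
      · exact (min_le_left _ _).trans (min_le_left _ _)
      · exact (min_le_left _ _).trans (min_le_right _ _)
      · exact (min_le_right _ _).trans (min_le_left _ _)
      · exact fun _ => (min_le_right _ _).trans (min_le_right _ _)
      · intro _; positivity
    · refine ⟨min (min ε X) vmax, ?_, ?_, ?_, ?_, ?_, ?_⟩
      · positivity
      · exact (min_le_left _ _).trans (min_le_left _ _)
      · exact (min_le_left _ _).trans (min_le_right _ _)
      · exact min_le_right _ _
      · exact fun h' => absurd h' hpp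
      · intro _; positivity
  have hbid : ∀ (i : Fin (n + 1)) (t : Bool), recordBid B L i t ∈ Set.Icc 0 vmax := by
    intro i t
    refine ⟨recordBid_nonneg hB0 hL0 i t, ?_⟩
    by_cases h : i ≠ 0 ∨ t = false
    · exact (recordBid_le hL0 h).trans hLv
    · push Not at h
      have ht : t = true := by simpa using h.2
      rw [h.1, ht, recordBid_zero_true]
      exact hBle
  have hq : ∀ s, G.prob s = recordWeight s * if s 0 = true then p else 1 - p :=
    prob_recordDensity hn hb hv hsymm
  have hM : ∀ s i, G.mean s i = recordWeight s * if s 0 = true then Y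
      else if i = lastRecord s then X else 0 := mean_recordDensity hn hb hv hsymm
  have hr0 : ∀ (i : Fin (n + 1)) t, 0 ≤ signalProb p i t := by
    intro i t
    unfold signalProb
    split_ifs
    · exact hp0
    · linarith
    · exact recordProb_nonneg _ _
  have hr1 : ∀ i : Fin (n + 1), signalProb p i true + signalProb p i false = 1 := by
    intro i
    by_cases hi : i = 0
    · simp [signalProb, hi]
    · simp only [signalProb, hi, if_false]; exact recordProb_add _
  have hprob : ∀ s, G.prob s = ∏ i, signalProb p i (s i) := fun s => by
    rw [hq, prod_signalProb]
  have hw0 : ∀ s : Fin (n + 1) → Bool, 0 ≤ recordWeight s := fun s => (recordWeight_pos s).le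
  -- when the first bidder's signal is high, `B` is the highest bid up to a null event
  have hhigh : ∀ s : Fin (n + 1) → Bool, s 0 = true → ∀ i x, G.prob s = recordWeight s * p ∧
      G.mean s i = G.prob s * B ∧ (0 < p → recordBid B L x (s x) ≤ B) := by
    intro s hs i x
    have e1 : G.prob s = recordWeight s * p := by rw [hq, if_pos hs]
    refine ⟨e1, ?_, fun hpp => ?_⟩
    · rw [hM, if_pos hs, e1, mul_assoc, hpB]
    · by_cases hx : x = 0
      · rw [hx, hs, recordBid_zero_true]
      · exact (recordBid_le hL0 (Or.inl hx)).trans (hLB hpp)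
  have hlow : ∀ s : Fin (n + 1) → Bool, s 0 = false → ∀ x,
      G.prob s * recordBid B L x (s x) ≤ recordWeight s * X := by
    intro s hs x
    have e1 : G.prob s = recordWeight s * (1 - p) := by rw [hq]; simp [hs]
    have h1 : recordBid B L x (s x) ≤ X := by
      refine (recordBid_le hL0 ?_).trans hLX
      by_cases hx : x = 0
      · right; rw [hx, hs]
      · exact Or.inl hx
    rw [e1, mul_assoc]
    refine mul_le_mul_of_nonneg_left ?_ (hw0 s)
    refine (mul_le_of_le_one_left (recordBid_nonneg hB0 hL0 _ _) (by linarith)).trans h1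
  have hMlow : ∀ s : Fin (n + 1) → Bool, s 0 = false → ∀ i, G.mean s i =
      if i = lastRecord s then recordWeight s * X else 0 := by
    intro s hs i
    rw [hM]
    simp [hs]
  have heff : G.info.IsEfficient (G.profile (recordBid B L) hbid) := by
    refine G.isEfficient_profile _ hbid hN hv fun s => ?_
    filter_upwards [hb, hv, winnerMean_pos_of_pos hv hsymm] with v h1 h2 h3 hpos
    have hpos' : 0 < (if s 0 = true then allPos v else winnerWeight (lastRecord s) v) :=
      pos_of_mul_pos_right hpos (hw0 s)
    have hconst : ∀ c : ℝ, (∀ i, v i = c) →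
        ∑ i, alloc i (fun k => recordBid B L k (s k)) * v i = ⨆ i, v i := by
      intro c hc
      simp only [hc]
      rw [← Finset.sum_mul, sum_alloc (by omega), one_mul, ciSup_const]
    rcases h1.cases hn fun i => (h2 i).1 with ⟨-, h4⟩ | rfl | ⟨h4, h5, k, hk, hk'⟩
    · exact hconst (v 0) fun i => h4 i 0
    · exact hconst 0 fun i => rfl
    -- Positive density at `v` excludes the high signal of bidder `0` and forces the last record to
    -- be the bidder with positive value. She outbids the others strictly because `L > 0`.
    · have hs : s 0 = false := by
        by_contra hs
        have hs' : s 0 = true := by simpa using hs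
        simp [hs', allPos, h4] at hpos'
      simp only [hs, Bool.false_eq_true, if_false] at hpos'
      have hkw : k = lastRecord s := by
        by_contra hne
        simp [winnerWeight, h4, h5, hk' _ (Ne.symm hne)] at hpos'
      have hLp := hLpos (h3 (lastRecord s) hpos' (hkw ▸ hk))
      have ha : alloc k (fun k => recordBid B L k (s k)) = 1 := by
        refine alloc_eq_one fun j hj => ?_
        simp only [hkw]
        exact recordBid_lt_lastRecord hLp hs (hkw ▸ hj)
      rw [Finset.sum_eq_single k (fun j _ hj => by rw [hk' j hj, mul_zero]) (by simp), ha, one_mul]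
      refine le_antisymm (le_ciSup (Set.finite_range v).bddAbove k) (ciSup_le fun j => ?_)
      by_cases hj : j = k
      · rw [hj]
      · rw [hk' j hj]; exact hk.le
  refine ⟨G.info, G.isPrivatePrivate hr0 hr1 hprob, G.profile (recordBid B L) hbid, ?_, ?_, heff, ?_⟩
  · refine G.noOverbidding_profile _ hbid hv fun i t ht => ?_
    have hrt : 0 < signalProb p i t := by
      have h1 := G.signalLaw_eq hr0 hr1 hprob i
      rw [h1, SignalDensity.boolLaw_singleton] at ht
      simpa using ht
    have hcase : ∀ s : Fin (n + 1) → Bool, s 0 = true → 0 < p →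
        0 < G.prob s ∧ G.prob s * recordBid B L i (s i) ≤ G.mean s i := by
      intro s hs hpp
      obtain ⟨e1, e2, e3⟩ := hhigh s hs i i
      have : 0 < G.prob s := by rw [e1]; exact mul_pos (recordWeight_pos s) hpp
      exact ⟨this, e2 ▸ mul_le_mul_of_nonneg_left (e3 hpp) this.le⟩
    by_cases hi : i = 0
    · subst hi
      cases t with
      | true =>
        have hpp : 0 < p := by simpa [signalProb] using hrt
        exact ⟨fun _ => true, rfl, hcase _ rfl hpp⟩
      | false =>
        have hpp : 0 < 1 - p := by simpa [signalProb] using hrt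
        have hl : lastRecord (fun _ : Fin (n + 1) => false) = 0 :=
          lastRecord_eq_iff.2 ⟨Or.inl rfl, fun _ _ => rfl⟩
        refine ⟨fun _ => false, rfl, ?_, ?_⟩
        · rw [hq]
          exact mul_pos (recordWeight_pos _) (by simpa using hpp)
        · refine (hlow (fun _ => false) rfl 0).trans_eq ?_
          rw [hMlow _ rfl, if_pos hl.symm]
    -- Good news for bidder `0`, when possible, gives the mean `B`, which covers every bid. If `p =
    -- 0`, the remaining signals are set low, so that a record `i` is the last one; a non-record
    -- bids `0`.
    · by_cases hpp : 0 < p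
      · refine ⟨Function.update (fun _ => true) i t, by simp, ?_⟩
        have := hcase (Function.update (fun _ => true) i t) (by simp [Ne.symm hi]) hpp
        simpa using this
      · have hp' : p = 0 := le_antisymm (not_lt.1 hpp) hp0
        have hs0 : Function.update (fun _ => false) i t 0 = false := by simp [Ne.symm hi]
        refine ⟨Function.update (fun _ => false) i t, by simp, ?_, ?_⟩
        · rw [hq, hs0, hp']
          exact mul_pos (recordWeight_pos _) (by simp)
        · cases t with
          | true =>
            have hl : lastRecord (Function.update (fun _ => false) i true) = i :=
              lastRecord_eq_iff.2 ⟨Or.inr (by simp), fun k hk => by simp [hk.ne']⟩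
            have := hlow _ hs0 i
            rw [hMlow _ hs0, if_pos hl.symm]
            simpa using this
          | false =>
            have : recordBid B L i false = 0 := by simp [recordBid, hi]
            rw [this, mul_zero, hMlow _ hs0]
            split_ifs
            · exact mul_nonneg (hw0 _) hX0
            · exact le_rfl
  -- After good news of positive probability every conditional mean is `B`, the highest bid: bidder
  -- `0` gains by winning at no more than `B`, and her rivals, facing the price `B`, are
  -- indifferent. After bad news the last record covers her price and the others have mean `0`.
  · refine G.isBNE_profile _ hbid hN hv ?_ ?_ ?_
    · intro s i j hj hmax hlt
      by_cases hs : s 0 = true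
      · obtain ⟨e1, e2, e3⟩ := hhigh s hs i j
        rw [e2]
        rcases hp0.eq_or_lt with h | h
        · simp [e1, ← h]
        · exact mul_le_mul_of_nonneg_left (e3 h) (G.prob_nonneg s)
      · have hs' : s 0 = false := by simpa using hs
        have hi : i = lastRecord s := by
          by_contra hi
          exact absurd ((recordBid_le_lastRecord hL0 hs' i).trans (hmax _ (Ne.symm hi)))
            (not_le.2 hlt)
        rw [hMlow s hs', if_pos hi]
        exact hlow s hs' j
    · intro s i j hj hmax hlt
      by_cases hs : s 0 = true
      · obtain ⟨e1, e2, -⟩ := hhigh s hs i j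
        rw [e2]
        rcases hp0.eq_or_lt with h | h
        · simp [e1, ← h]
        · refine mul_le_mul_of_nonneg_left ?_ (G.prob_nonneg s)
          have hB0' : recordBid B L (0 : Fin (n + 1)) (s 0) = B := by rw [hs, recordBid_zero_true]
          by_cases hi : i = 0
          · rw [hi, hB0'] at hlt; exact hlt.le
          · exact hB0'.symm.trans_le (hmax 0 (Ne.symm hi))
      · have hs' : s 0 = false := by simpa using hs
        have hi : i ≠ lastRecord s := by
          rintro rfl
          exact absurd (recordBid_le_lastRecord hL0 hs' j) (not_le.2 hlt)
        rw [hMlow s hs', if_neg hi]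
        exact mul_nonneg (G.prob_nonneg s) (recordBid_nonneg hB0 hL0 _ _)
    · intro s i j hj hmax heq
      by_cases hs : s 0 = true
      · obtain ⟨e1, e2, e3⟩ := hhigh s hs i j
        rw [e2]
        rcases hp0.eq_or_lt with h | h
        · simp [e1, ← h]
        · have hB0' : recordBid B L (0 : Fin (n + 1)) (s 0) = B := by rw [hs, recordBid_zero_true]
          congr 1
          refine le_antisymm ?_ (e3 h)
          by_cases hi : i = 0
          · rw [← heq, hi, hB0']
          · exact hB0'.symm.trans_le (hmax 0 (Ne.symm hi))
      · have hs' : s 0 = false := by simpa using hs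
        -- After bad news a strict ladder admits no tie at the top, so a tie forces `L = 0`, hence
        -- `X = 0`, and both sides vanish.
        have hL : L = 0 := by
          by_contra hne
          have hLp : 0 < L := hL0.lt_of_ne' hne
          by_cases hi : i = lastRecord s
          · have := recordBid_lt_lastRecord (B := B) hLp hs' (k := j) (hi ▸ hj)
            rw [← hi, heq] at this
            exact lt_irrefl _ this
          · have h1 := recordBid_lt_lastRecord (B := B) hLp hs' hi
            have h2 := hmax _ (Ne.symm hi)
            linarith
        have hXz : X = 0 := by
          by_contra hne
          exact (hLpos (hX0.lt_of_ne' hne)).ne' hL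
        have hz : G.prob s * recordBid B L j (s j) = 0 := by
          refine le_antisymm ?_ (mul_nonneg (G.prob_nonneg s) (recordBid_nonneg hB0 hL0 _ _))
          simpa [hXz] using hlow s hs' j
        rw [hz, hMlow s hs', hXz]
        simp
  · refine G.maxWelfare_sub_le_bidderSurplus _ hbid hN hv heff fun s => ?_
    -- Of two distinct bidders one is not bidder `0`, and her bid is at most `L`.
    refine secmax_le hN fun i j hij => ?_
    by_cases hi : i = 0
    · exact (min_le_right _ _).trans
        ((recordBid_le hL0 (Or.inl fun hj => hij (hi.trans hj.symm))).trans hLε)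
    · exact (min_le_left _ _).trans ((recordBid_le hL0 (Or.inl hi)).trans hLε)

end Construction

end SecondPrice

end

theorem mainTheorem4 (N : ℕ) (hN : 2 ≤ N)
    (V : Set ℝ) (hVc : V.Countable) (hV : V ⊆ Set.Icc 0 1) (vmax : ℝ) (hvmax : IsGreatest V vmax)
    (lam : PMF (Fin N → ℝ)) (hlam : ∀ v ∈ lam.support, ∀ i, v i ∈ V)
    (hsymm : ∀ (τ : Equiv.Perm (Fin N)) (v : Fin N → ℝ), lam (v ∘ τ) = lam v) :
    (∀ ε : ℝ, 0 < ε →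
      ∃ I : SecondPrice.InfoStructure lam, I.IsPrivatePrivate ∧
        ∃ σ : I.Profile vmax,
          I.NoOverbidding σ ∧ I.IsBNE σ ∧ I.IsEfficient σ ∧
            SecondPrice.maxWelfare lam - ε ≤ I.bidderSurplus σ) ↔
    (∀ v ∈ lam.support,
      (∀ i j, v i = v j) ∨ ∃ i, 0 < v i ∧ ∀ j, j ≠ i → v j = 0) := by
  have hvs : ∀ v ∈ lam.support, ∀ i, v i ∈ Set.Icc (0 : ℝ) 1 ∧ v i ≤ vmax := fun v hv i =>
    ⟨hV (hlam v hv i), hvmax.2 (hlam v hv i)⟩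
  constructor
  · intro h v hv
    exact SecondPrice.eq_or_single_of_exists hN hvs hsymm h hv
  · intro h ε hε
    obtain ⟨n, rfl⟩ : ∃ n, N = n + 1 := ⟨N - 1, by omega⟩
    have hsupp := SecondPrice.ae_mem_support lam
    exact SecondPrice.exists_of_equalOrSingle (by omega)
      (hsupp.mono fun v hv => h v hv) (hsupp.mono fun v hv i => (hvs v hv i).1)
      (hsupp.mono fun v hv i => (hvs v hv i).2) (hV hvmax.1).1 hsymm hε
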